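/- For $q,s\in\mathbb{C}$ with $|q|<1$ let $$\mathcal{L}_q(s)=\sum_{n=1}^\infty \frac{n^s q^n}{1-q^n},\qquad \mathcal{L}_q^{[N]}(s)=\sum_{n=1}^N \frac{n^s q^n}{1-q^n}$$ be the Lambert series and its partial sums. Let $B_n$ denote the Bernoulli numbers. For an integer $k\ge 1$ put $$\beta_{jk}=\frac{1+(1+i)^{4k+1-2j}}{2^{4k+1-2j}}-\frac{1+(1+i)^{2j-1}}{2^{2j-1}},$$ $$a_k=\frac{2^{4k}(3^{4k+1}+1)}{2^{4k+1}-(-1)^k2^{2k}+1},\qquad b_k=\frac{3^{4k+1}-1}{2}-(-1)^k2^{2k}-a_k\,\frac{2^{4k+1}-(-1)^k2^{2k}-1}{2^{4k+1}},$$ $$c_{jk}=3^{2j-1}\sum_{n=-1}^{1}(1+in)^{4k+1-2j}-3^{4k+1-2j}\sum_{n=-1}^{1}(1+in)^{2j-1}-a_k\beta_{jk},$$ $$a'_k=\frac{2^{4k+1}-(-1)^k2^{2k}+1}{2^{4k}\left[5^{4k+1}-2\cdot 5^{2k}\cos(4k\arctan 2)+1\right]},\qquad b'_k=\frac{a'_k}{2}\Big[5^{4k+1}-\sum_{n=-2}^{2}(1+in)^{4k}\Big]-\frac{2^{4k+1}-(-1)^k2^{2k}-1}{2^{4k+1}},$$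 $$c'_{jk}=a'_k\Big[5^{2j-1}\sum_{n=-2}^{2}(1+in)^{4k+1-2j}-5^{4k+1-2j}\sum_{n=-2}^{2}(1+in)^{2j-1}\Big]-\beta_{jk},$$ $$P_k=\frac{2^{4k+1}}{2b_k}\sum_{j=0}^k\frac{(-1)^{j+1}c_{jk}B_{2j}B_{4k+2-2j}}{(2j)!\,(4k+2-2j)!},\qquad P'_k=\frac{2^{4k+1}}{2b'_k}\sum_{j=0}^k\frac{(-1)^{j+1}c'_{jk}B_{2j}B_{4k+2-2j}}{(2j)!\,(4k+2-2j)!}.$$ For a function $F:\mathbb{C}\to\mathbb{C}$ put $$T_k(F)=\frac{(-1)^k2^{2k+1}}{b_k}F(-e^{-3\pi})-\frac{a_k}{2^{4k-1}b_k}F(e^{-4\pi})+\frac{2}{b_k}F(e^{-6\pi}),$$ $$T'_k(F)=-\frac{1}{2^{4k-1}b'_k}F(e^{-4\pi})+\frac{(-1)^k2^{2k+1}a'_k}{b'_k}F(-e^{-5\pi})+\frac{2a'_k}{b'_k}F(e^{-10\pi}).$$ **Proposition.** Let $k\ge1$ be an integer, and write $\mathcal{L}(q)=\mathcal{L}_q(-4k-1)$,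 $\mathcal{L}^{[N]}(q)=\mathcal{L}_q^{[N]}(-4k-1)$. 1. The two formulas $$\zeta(4k+1)=P_k\,\pi^{4k+1}+T_k(\mathcal{L}),\qquad \zeta(4k+1)=P'_k\,\pi^{4k+1}+T'_k(\mathcal{L})$$ hold, $P_k\neq P'_k$, and eliminating $\zeta(4k+1)$ from them gives $$\pi^{4k+1}=\frac{T'_k(\mathcal{L})-T_k(\mathcal{L})}{P_k-P'_k},$$ a linear combination of $\mathcal{L}_q(-4k-1)$ at $q=-e^{-3\pi},\,e^{-4\pi},\,-e^{-5\pi},\,e^{-6\pi},\,e^{-10\pi}$. 2. The truncation error $$R_N=\pi^{4k+1}-\frac{T'_k(\mathcal{L}^{[N]})-T_k(\mathcal{L}^{[N]})}{P_k-P'_k}$$ satisfies $R_N=O(e^{-3\pi N})$ as $N\to\infty$. In particular the convergence is faster than for every series in terms of $\mathcal{L}_q$ at $q=e^{-\pi},e^{-2\pi},e^{-4\pi}$ in which the first one occurs: for all $u,v,w\in\mathbb{C}$ with $u\ne0$, $$R_N=o\Big(u\big[\mathcal{L}(e^{-\pi})-\mathcal{L}^{[N]}(e^{-\pi})\big]+v\big[\mathcal{L}(e^{-2\pi})-\mathcal{L}^{[N]}(e^{-2\pi})\big]+w\big[\mathcal{L}(e^{-4\pi})-\mathcal{L}^{[N]}(e^{-4\pi})\big]\Big)\quad(N\to\infty).$$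 3. For $k=1$, the combination $\big(T'_1(F)-T_1(F)\big)/(P_1-P'_1)$ is, for every $F:\mathbb{C}\to\mathbb{C}$, $$-3686634\,F(-e^{-3\pi})+2463048\,F(e^{-4\pi})+402570\,F(-e^{-5\pi})+\tfrac{1843317}{2}F(e^{-6\pi})-\tfrac{201285}{2}F(e^{-10\pi}),$$ and hence $$\pi^5=-3686634\,\mathcal{L}_{-e^{-3\pi}}(-5)+2463048\,\mathcal{L}_{e^{-4\pi}}(-5)+402570\,\mathcal{L}_{-e^{-5\pi}}(-5)+\tfrac{1843317}{2}\mathcal{L}_{e^{-6\pi}}(-5)-\tfrac{201285}{2}\mathcal{L}_{e^{-10\pi}}(-5).$$ -/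

import Mathlib

noncomputable section

/-- The `n`-th term `n ^ s * q ^ n / (1 - q ^ n)` of the Lambert series `L_q(s)`. -/
def lambertTerm (q s : ℂ) (n : ℕ) : ℂ :=
  (n : ℂ) ^ s * q ^ n / (1 - q ^ n)

/-- The Lambert series `L_q(s) = ∑_{n ≥ 1} n ^ s * q ^ n / (1 - q ^ n)`, for `|q| < 1`. -/
def lambertL (q s : ℂ) : ℂ :=
  ∑' n : ℕ, lambertTerm q s (n + 1)

/-- The partial sum over `1 ≤ n ≤ N` of the Lambert series `L_q(s)`. -/
def lambertPartial (q s : ℂ) (N : ℕ) : ℂ :=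
  ∑ n ∈ Finset.Icc 1 N, lambertTerm q s n

/-- The Lambert series converges absolutely for `|q| < 1` and every complex `s`. -/
theorem summable_lambertTerm {q : ℂ} (hq : ‖q‖ < 1) (s : ℂ) :
    Summable (fun n : ℕ => lambertTerm q s (n + 1)) := by
  obtain ⟨d, hd⟩ := exists_nat_ge s.re
  have h0 : Summable (fun n : ℕ => (n : ℝ) ^ d * ‖q‖ ^ n) :=
    summable_pow_mul_geometric_of_norm_lt_one d (by simpa using hq)
  have h1 := (((summable_nat_add_iff 1).2 h0).mul_right (1 - ‖q‖)⁻¹)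
  refine Summable.of_norm_bounded h1 (fun n => ?_)
  have hpos : 0 < 1 - ‖q‖ := by linarith
  have hpow : ‖q‖ ^ (n + 1) ≤ ‖q‖ :=
    pow_le_of_le_one (norm_nonneg q) hq.le (Nat.succ_ne_zero n)
  have hden : 1 - ‖q‖ ≤ ‖1 - q ^ (n + 1)‖ := by
    have h := norm_sub_norm_le (1 : ℂ) (q ^ (n + 1))
    rw [norm_one, norm_pow] at h
    linarith
  have hn1 : (1 : ℝ) ≤ ((n + 1 : ℕ) : ℝ) := by
    exact_mod_cast Nat.succ_le_succ (Nat.zero_le n)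
  have hs : ‖(((n + 1 : ℕ) : ℂ)) ^ s‖ ≤ ((n + 1 : ℕ) : ℝ) ^ d := by
    rw [Complex.norm_natCast_cpow_of_pos (Nat.succ_pos n), ← Real.rpow_natCast]
    exact Real.rpow_le_rpow_of_exponent_le hn1 hd
  unfold lambertTerm
  rw [norm_div, norm_mul, norm_pow, div_eq_mul_inv]
  gcongr

/-- The real number `e ^ (-m π)`, as a complex number. -/
def expPi (m : ℝ) : ℂ :=
  ((Real.exp (-(m * Real.pi)) : ℝ) : ℂ)

/-- `∑_{j = 0}^{k} (-1) ^ (j + 1) c_j B_{2j} B_{4k + 2 - 2j} / ((2j)! (4k + 2 - 2j)!)`,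
where `B_n` are the Bernoulli numbers. -/
def bernoulliSum (k : ℕ) (c : ℕ → ℂ) : ℂ :=
  ∑ j ∈ Finset.range (k + 1),
    (-1) ^ (j + 1) * c j * ((bernoulli (2 * j) : ℚ) : ℂ) *
        ((bernoulli (4 * k + 2 - 2 * j) : ℚ) : ℂ) /
      (((2 * j).factorial : ℂ) * ((4 * k + 2 - 2 * j).factorial : ℂ))

/-- `∑_{n = -h}^{h} (1 + i n) ^ e`. -/
def gaussianPowerSum (h e : ℤ) : ℂ :=
  ∑ n ∈ Finset.Icc (-h) h, (1 + Complex.I * (n : ℂ)) ^ e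

/-- `(1 + (1 + i) ^ (4k + 1 - 2j)) / 2 ^ (4k + 1 - 2j) - (1 + (1 + i) ^ (2j - 1)) / 2 ^ (2j - 1)`. -/
def twoBracket (k j : ℕ) : ℂ :=
  (1 + (1 + Complex.I) ^ (4 * (k : ℤ) + 1 - 2 * j)) / 2 ^ (4 * (k : ℤ) + 1 - 2 * j) -
    (1 + (1 + Complex.I) ^ (2 * (j : ℤ) - 1)) / 2 ^ (2 * (j : ℤ) - 1)

/-- `p ^ (2j - 1) ∑_{|n| ≤ h} (1 + i n) ^ (4k + 1 - 2j)
  - p ^ (4k + 1 - 2j) ∑_{|n| ≤ h} (1 + i n) ^ (2j - 1)`, to be used with `p = 2 h + 1`. -/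
def oddBracket (p : ℂ) (h : ℤ) (k j : ℕ) : ℂ :=
  p ^ (2 * (j : ℤ) - 1) * gaussianPowerSum h (4 * (k : ℤ) + 1 - 2 * j) -
    p ^ (4 * (k : ℤ) + 1 - 2 * j) * gaussianPowerSum h (2 * (j : ℤ) - 1)

/-! ### The constants of the `p = 3` formula for `ζ(4k + 1)` -/

def threeA (k : ℕ) : ℂ :=
  2 ^ (4 * k) * (3 ^ (4 * k + 1) + 1) / (2 ^ (4 * k + 1) - (-1) ^ k * 2 ^ (2 * k) + 1)

def threeB (k : ℕ) : ℂ :=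
  (3 ^ (4 * k + 1) - 1) / 2 - (-1) ^ k * 2 ^ (2 * k) -
    threeA k * ((2 ^ (4 * k + 1) - (-1) ^ k * 2 ^ (2 * k) - 1) / 2 ^ (4 * k + 1))

def threeC (k j : ℕ) : ℂ :=
  oddBracket 3 1 k j - threeA k * twoBracket k j

/-- The coefficient of `π ^ (4k + 1)` in the `p = 3` formula. -/
def threePi (k : ℕ) : ℂ :=
  2 ^ (4 * k + 1) / (2 * threeB k) * bernoulliSum k (threeC k)

/-! ### The constants of the `p = 5` formula for `ζ(4k + 1)` -/

def fiveA (k : ℕ) : ℂ :=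
  (2 ^ (4 * k + 1) - (-1) ^ k * 2 ^ (2 * k) + 1) /
    (2 ^ (4 * k) * (5 ^ (4 * k + 1) -
      2 * 5 ^ (2 * k) * ((Real.cos (4 * k * Real.arctan 2) : ℝ) : ℂ) + 1))

def fiveB (k : ℕ) : ℂ :=
  fiveA k / 2 * (5 ^ (4 * k + 1) - gaussianPowerSum 2 (4 * k)) -
    (2 ^ (4 * k + 1) - (-1) ^ k * 2 ^ (2 * k) - 1) / 2 ^ (4 * k + 1)

def fiveC (k j : ℕ) : ℂ :=
  fiveA k * oddBracket 5 2 k j - twoBracket k j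

/-- The coefficient of `π ^ (4k + 1)` in the `p = 5` formula. -/
def fivePi (k : ℕ) : ℂ :=
  2 ^ (4 * k + 1) / (2 * fiveB k) * bernoulliSum k (fiveC k)

/-! ### The Lambert series parts of the formulas

Here `F q` is either the Lambert series `L_q(-4k - 1)` or one of its partial sums. -/

/-- The Lambert series part of the `p = 3` formula. -/
def threeLambert (k : ℕ) (F : ℂ → ℂ) : ℂ :=
  (-1) ^ k * 2 ^ (2 * k + 1) / threeB k * F (-expPi 3) -
    threeA k / (2 ^ (4 * k - 1) * threeB k) * F (expPi 4) +
    2 ^ (2 * k) / (2 ^ (2 * k - 1) * threeB k) * F (expPi 6)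

/-- The Lambert series part of the `p = 5` formula. -/
def fiveLambert (k : ℕ) (F : ℂ → ℂ) : ℂ :=
  -(1 / (2 ^ (4 * k - 1) * fiveB k)) * F (expPi 4) +
    (-1) ^ k * 2 ^ (2 * k + 1) * fiveA k / fiveB k * F (-expPi 5) +
    2 * fiveA k / fiveB k * F (expPi 10)

/-- The combination for `π ^ (4k + 1)`, obtained from
`threePi k * π ^ (4k + 1) + threeLambert k F = fivePi k * π ^ (4k + 1) + fiveLambert k F`. -/
def combinedLambert (k : ℕ) (F : ℂ → ℂ) : ℂ :=
  (fiveLambert k F - threeLambert k F) / (threePi k - fivePi k)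

end

/-! Write $C(\tau)=\sum_n i\cot(\pi n\tau)/n^s$ with $s=4k+1$. Since $i\cot\pi z=1+2y/(1-y)$ for
$y=e^{2\pi iz}$, $C(\tau)=\zeta(s)+2\mathcal L_y(-s)$ with $y=e^{2\pi i\tau}$ (`cotSum_eq`). So $C$
has period 1, and it behaves like an Eichler integral of an Eisenstein series: it satisfies a Hecke
relation with eigenvalue $p^s+1$ for each prime $p$ (`cotSum_hecke`), and
$C(\tau)-\tau^{4k}C(-1/\tau)$ is an explicit Bernoulli expression times $\pi^{4k+1}$
(`cotSum_eq_pow_mul_cotSum_add`).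

Apply the Hecke relation at the fixed point $\tau=i$. Inversion followed by a translation carries
the points $(i+b)/p$ to $pi$, to $(1+pi)/2$, or back to $i$. For $p=2,3,5$ this gives three linear
relations in which $C(i)$ is the only unwanted quantity (`cotSum_hecke_two`, `cotSum_hecke_three`,
`cotSum_hecke_five`). Eliminating $C(i)$ between $p=2$ and $p=3$ gives the first zeta formula,
between $p=2$ and $p=5$ the second.

If $P_k=P'_k$, the Lambert parts would agree, that is $M'G_3=MG_5$ with $0<M\le M'$. But
$|G_5|<|G_3|$, because $G_3$ is dominated by its term at $-e^{-3\pi}$, the largest nome present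
(`threePi_ne_fivePi`). The convergence statements compare tails: every nome used has modulus at most
$e^{-3\pi}$, whereas the tail at $e^{-\pi}$ decays no faster than $e^{-\pi N}$ up to a power of $N$.
-/

open Complex in
/-- The cotangent Dirichlet series `∑ i cot(π n τ) / n ^ s`. -/
noncomputable def cotSum (s : ℕ) (τ : ℂ) : ℂ :=
  ∑' n : ℕ, I * cot (Real.pi * (n * τ)) / (n : ℂ) ^ s

/-! ### Cotangent series, Lambert series and the Hecke relation. -/

section CotangentSeries

open Complex

theorem norm_exp_two_pi_I_mul_lt_one {z : ℂ} (hz : 0 < z.im) :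
    ‖exp (2 * Real.pi * I * z)‖ < 1 :=
  UpperHalfPlane.norm_exp_two_pi_I_lt_one ⟨z, hz⟩

theorem one_sub_exp_two_pi_I_mul_ne_zero {z : ℂ} (hz : 0 < z.im) :
    1 - exp (2 * Real.pi * I * z) ≠ 0 := by
  intro h
  have h1 := norm_exp_two_pi_I_mul_lt_one hz
  rw [← sub_eq_zero.mp h, norm_one] at h1
  exact lt_irrefl _ h1

theorem I_mul_cot_pi_mul {z : ℂ} (hz : 0 < z.im) :
    I * cot (Real.pi * z) =
      1 + 2 * (exp (2 * Real.pi * I * z) / (1 - exp (2 * Real.pi * I * z))) := by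
  have h := one_sub_exp_two_pi_I_mul_ne_zero hz
  rw [cot_pi_eq_exp_ratio]
  generalize exp (2 * Real.pi * I * z) = y at h
  field_simp
  ring

theorem lambertTerm_neg_natCast (q : ℂ) (s n : ℕ) :
    lambertTerm q (-(s : ℂ)) n = q ^ n / (1 - q ^ n) / (n : ℂ) ^ s := by
  rw [lambertTerm, cpow_neg, cpow_natCast]
  ring

theorem hasSum_riemannZeta_natCast {s : ℕ} (hs : 1 < s) :
    HasSum (fun n : ℕ => 1 / (n : ℂ) ^ s) (riemannZeta s) := by
  rw [zeta_nat_eq_tsum_of_gt_one hs]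
  refine Summable.hasSum (Summable.of_norm ?_)
  simpa using Real.summable_one_div_nat_pow.mpr hs

theorem hasSum_cot_div_pow {s : ℕ} (hs : 1 < s) {τ : ℂ} (hτ : 0 < τ.im) :
    HasSum (fun n : ℕ => I * cot (Real.pi * (n * τ)) / (n : ℂ) ^ s)
      (riemannZeta s + 2 * lambertL (exp (2 * Real.pi * I * τ)) (-(s : ℂ))) := by
  have h1 := hasSum_riemannZeta_natCast hs
  have h2 : HasSum (fun n : ℕ => lambertTerm (exp (2 * Real.pi * I * τ)) (-(s : ℂ)) n)
      (lambertL (exp (2 * Real.pi * I * τ)) (-(s : ℂ))) := by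
    have h := (summable_lambertTerm (norm_exp_two_pi_I_mul_lt_one hτ) (-(s : ℂ))).hasSum
    rw [hasSum_nat_add_iff (f := lambertTerm _ _), Finset.sum_range_one,
      show lambertTerm (exp (2 * Real.pi * I * τ)) (-(s : ℂ)) 0 = 0 by
        simp [lambertTerm_neg_natCast], add_zero] at h
    exact h
  convert h1.add (h2.mul_left 2) using 2 with n
  rcases Nat.eq_zero_or_pos n with rfl | hn
  · simp [lambertTerm_neg_natCast, show s ≠ 0 by omega]
  · have him : 0 < ((n : ℂ) * τ).im := by
      rw [← nsmul_eq_mul]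
      simp only [nsmul_eq_mul, mul_im, natCast_re, natCast_im, zero_mul, add_zero]
      positivity
    rw [I_mul_cot_pi_mul him, lambertTerm_neg_natCast, ← exp_nat_mul,
      show (n : ℂ) * (2 * Real.pi * I * τ) = 2 * Real.pi * I * (n * τ) by ring]
    ring

theorem cotSum_eq {s : ℕ} (hs : 1 < s) {τ : ℂ} (hτ : 0 < τ.im) :
    cotSum s τ = riemannZeta s + 2 * lambertL (exp (2 * Real.pi * I * τ)) (-(s : ℂ)) :=
  (hasSum_cot_div_pow hs hτ).tsum_eq

theorem cotSum_add_intCast {s : ℕ} (hs : 1 < s) {τ : ℂ} (hτ : 0 < τ.im) (m : ℤ) :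
    cotSum s (τ + m) = cotSum s τ := by
  rw [cotSum_eq hs hτ, cotSum_eq hs (by simpa using hτ), mul_add, exp_add,
    show 2 * Real.pi * I * (m : ℂ) = m * (2 * Real.pi * I) by ring, exp_int_mul_two_pi_mul_I,
    mul_one]

/-- Each summand is a geometric sum of length $p$ over the common denominator $1-x^p$; summing over
$b$ kills every power $x^j$ with $0<j<p$. -/
theorem IsPrimitiveRoot.sum_inv_one_sub_pow_mul {K : Type*} [Field K] {p : ℕ} (hp : 1 < p)
    {ζ x : K} (hζ : IsPrimitiveRoot ζ p) (hx : 1 - x ^ p ≠ 0) :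
    ∑ b ∈ Finset.range p, (1 - ζ ^ b * x)⁻¹ = p * (1 - x ^ p)⁻¹ := by
  have h1 : ∀ b : ℕ, (1 - ζ ^ b * x)⁻¹ =
      (∑ j ∈ Finset.range p, ζ ^ (b * j) * x ^ j) * (1 - x ^ p)⁻¹ := by
    intro b
    have h2 : (∑ j ∈ Finset.range p, ζ ^ (b * j) * x ^ j) * (1 - ζ ^ b * x) = 1 - x ^ p := by
      have h3 := geom_sum_mul_neg (ζ ^ b * x) p
      simp only [mul_pow, ← pow_mul] at h3
      rwa [mul_comm b p, pow_mul, hζ.pow_eq_one, one_pow, one_mul] at h3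
    have h4 : 1 - ζ ^ b * x ≠ 0 := by
      intro h
      rw [h, mul_zero] at h2
      exact hx h2.symm
    rw [← h2, mul_inv, mul_left_comm, inv_mul_cancel_left₀ (left_ne_zero_of_mul (h2 ▸ hx))]
  simp_rw [h1]
  rw [← Finset.sum_mul, Finset.sum_comm]
  congr 1
  rw [Finset.sum_eq_single_of_mem 0 (Finset.mem_range.mpr (by omega))]
  · simp
  · intro j hj hj0
    rw [← Finset.sum_mul]
    have h5 : (∑ b ∈ Finset.range p, ζ ^ (b * j)) * (ζ ^ j - 1) = 0 := by
      have h6 := geom_sum_mul (ζ ^ j) p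
      simp only [← pow_mul] at h6
      rw [mul_comm j p, pow_mul, hζ.pow_eq_one, one_pow, sub_self] at h6
      simpa only [mul_comm j] using h6
    have h7 : ζ ^ j - 1 ≠ 0 := by
      refine sub_ne_zero.mpr (hζ.pow_ne_one_of_pos_of_lt hj0 (Finset.mem_range.mp hj))
    rw [(mul_eq_zero.mp h5).resolve_right h7, zero_mul]

theorem I_mul_cot_pi_mul_eq_inv {z : ℂ} (hz : 0 < z.im) :
    I * cot (Real.pi * z) = 2 * (1 - exp (2 * Real.pi * I * z))⁻¹ - 1 := by
  have h := one_sub_exp_two_pi_I_mul_ne_zero hz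
  rw [cot_pi_eq_exp_ratio]
  generalize exp (2 * Real.pi * I * z) = y at h
  field_simp
  ring

theorem natCast_mul_im_pos {n : ℕ} (hn : 0 < n) {τ : ℂ} (hτ : 0 < τ.im) :
    0 < ((n : ℂ) * τ).im := by
  simp only [mul_im, natCast_re, natCast_im, zero_mul, add_zero]
  positivity

/-- Distribution relation of the cotangent: for $n$ prime to $p$, $e^{2\pi in/p}$ is a primitive
$p$-th root of unity, so the root-of-unity sum applies. -/
theorem sum_I_mul_cot_of_coprime {p n : ℕ} (hp : 1 < p) (hn : n.Coprime p) (hn0 : 0 < n)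
    {τ : ℂ} (hτ : 0 < τ.im) :
    ∑ b ∈ Finset.range p, I * cot (Real.pi * (n * ((τ + b) / p))) =
      p * (I * cot (Real.pi * (n * τ))) := by
  have hp0 : (p : ℂ) ≠ 0 := by exact_mod_cast (by omega : p ≠ 0)
  have hpr : (0 : ℝ) < p := by exact_mod_cast (by omega : 0 < p)
  set x := exp (2 * Real.pi * I * (n * (τ / p))) with hx
  have hxp : x ^ p = exp (2 * Real.pi * I * (n * τ)) := by
    rw [hx, ← exp_nat_mul]
    congr 1
    field_simp
  have hx1 : 1 - x ^ p ≠ 0 := by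
    rw [hxp]
    exact one_sub_exp_two_pi_I_mul_ne_zero (natCast_mul_im_pos hn0 hτ)
  have hζ := isPrimitiveRoot_exp_of_coprime n p (by omega) hn
  have h2 : ∀ b ∈ Finset.range p, I * cot (Real.pi * (n * ((τ + b) / p))) =
      2 * (1 - exp (2 * Real.pi * I * (n / p)) ^ b * x)⁻¹ - 1 := by
    intro b _
    have him : 0 < ((τ + b) / p).im := by
      rw [div_natCast_im]
      simp only [add_im, natCast_im, add_zero]
      positivity
    rw [I_mul_cot_pi_mul_eq_inv (natCast_mul_im_pos hn0 him), hx, ← exp_nat_mul, ← exp_add]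
    congr 4
    field_simp
    ring_nf
  rw [Finset.sum_congr rfl h2, Finset.sum_sub_distrib, ← Finset.mul_sum,
    hζ.sum_inv_one_sub_pow_mul hp hx1, hxp, I_mul_cot_pi_mul_eq_inv (natCast_mul_im_pos hn0 hτ)]
  simp
  ring

/-- Here the shift by $b$ moves the argument by the integer $mb$, so all $p$ summands coincide. -/
theorem sum_I_mul_cot_of_dvd {p : ℕ} (hp : p ≠ 0) (m : ℕ) {τ : ℂ} (hτ : 0 < τ.im) :
    ∑ b ∈ Finset.range p, I * cot (Real.pi * ((p * m : ℕ) * ((τ + b) / p))) =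
      p * (I * cot (Real.pi * (m * τ))) := by
  have hp0 : (p : ℂ) ≠ 0 := by exact_mod_cast hp
  rcases Nat.eq_zero_or_pos m with rfl | hm
  · simp [Complex.cot]
  have h : ∀ b ∈ Finset.range p, I * cot (Real.pi * ((p * m : ℕ) * ((τ + b) / p))) =
      I * cot (Real.pi * (m * τ)) := by
    intro b _
    have h1 : ((p * m : ℕ) : ℂ) * ((τ + b) / p) = m * τ + (m * b : ℕ) := by
      push_cast
      field_simp
    have him := natCast_mul_im_pos hm hτ
    rw [h1, I_mul_cot_pi_mul_eq_inv him, I_mul_cot_pi_mul_eq_inv (by simpa using him), mul_add, exp_add,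
      show 2 * Real.pi * I * ((m * b : ℕ) : ℂ) = (m * b : ℕ) * (2 * Real.pi * I) by ring,
      exp_nat_mul_two_pi_mul_I, mul_one]
  rw [Finset.sum_congr rfl h, Finset.sum_const, Finset.card_range, nsmul_eq_mul]

theorem cotSum_hecke {s p : ℕ} (hs : 1 < s) (hp : p.Prime) {τ : ℂ} (hτ : 0 < τ.im) :
    cotSum s (p * τ) + (p : ℂ) ^ (s - 1) * ∑ b ∈ Finset.range p, cotSum s ((τ + b) / p) =
      ((p : ℂ) ^ s + 1) * cotSum s τ := by
  have hp0 : (p : ℂ) ≠ 0 := by exact_mod_cast hp.ne_zero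
  have hpr : (0 : ℝ) < p := by exact_mod_cast hp.pos
  set g : ℕ → ℂ := fun n => I * cot (Real.pi * (n * τ)) / (n : ℂ) ^ s with hg
  set g' : ℕ → ℂ := fun n => I * cot (Real.pi * (n * (p * τ))) / (n : ℂ) ^ s with hg'
  -- The correction at $n=pm$: there the sum over $b$ is $g(m)/p^{s-1}$ instead of the generic
  -- $p\,g(pm)=g'(m)/p^{s-1}$.
  set h : ℕ → ℂ := fun n => if p ∣ n then (g (n / p) - g' (n / p)) / (p : ℂ) ^ (s - 1) else 0 with hh
  have hsg : HasSum g (cotSum s τ) := (hasSum_cot_div_pow hs hτ).summable.hasSum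
  have hsg' : HasSum g' (cotSum s (p * τ)) :=
    (hasSum_cot_div_pow hs (natCast_mul_im_pos hp.pos hτ)).summable.hasSum
  have hsh : HasSum h ((cotSum s τ - cotSum s (p * τ)) / (p : ℂ) ^ (s - 1)) := by
    have hinj : Function.Injective (fun m : ℕ => p * m) := fun a b hab =>
      Nat.eq_of_mul_eq_mul_left hp.pos hab
    rw [← hinj.hasSum_iff]
    · have hcomp : h ∘ (fun m : ℕ => p * m) = fun m => (g m - g' m) / (p : ℂ) ^ (s - 1) := by
        funext m
        simp [hh, Nat.mul_div_cancel_left _ hp.pos]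
      rw [hcomp]
      exact (hsg.sub hsg').div_const _
    · intro n hn
      have : ¬ p ∣ n := fun ⟨m, hm⟩ => hn ⟨m, hm.symm⟩
      simp [hh, this]
  have hsum : HasSum (fun n : ℕ => ∑ b ∈ Finset.range p,
      I * cot (Real.pi * (n * ((τ + b) / p))) / (n : ℂ) ^ s)
      (∑ b ∈ Finset.range p, cotSum s ((τ + b) / p)) := by
    refine hasSum_sum fun b _ => ?_
    have him : 0 < ((τ + b) / p).im := by
      rw [div_natCast_im]
      simp only [add_im, natCast_im, add_zero]
      positivity
    exact (hasSum_cot_div_pow hs him).summable.hasSum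
  have hterm : (fun n : ℕ => ∑ b ∈ Finset.range p,
      I * cot (Real.pi * (n * ((τ + b) / p))) / (n : ℂ) ^ s) = fun n => p * g n + h n := by
    funext n
    rw [← Finset.sum_div]
    by_cases hn : p ∣ n
    · obtain ⟨m, rfl⟩ := hn
      have hps : (p : ℂ) ^ s = p * p ^ (s - 1) := by
        rw [← pow_succ']; congr 1; omega
      rw [sum_I_mul_cot_of_dvd hp.ne_zero m hτ]
      simp only [hh, hg, hg', dvd_mul_right, if_true, Nat.mul_div_cancel_left _ hp.pos]
      push_cast
      rw [show (p : ℂ) * m * τ = m * (p * τ) by ring, mul_pow, hps]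
      rcases Nat.eq_zero_or_pos m with rfl | hm
      · simp [Complex.cot]
      have hm0 : (m : ℂ) ≠ 0 := by exact_mod_cast hm.ne'
      field_simp
      ring
    · have hn0 : 0 < n := Nat.pos_of_ne_zero fun h0 => hn (h0 ▸ dvd_zero p)
      rw [sum_I_mul_cot_of_coprime hp.one_lt ((hp.coprime_iff_not_dvd.mpr hn).symm) hn0 hτ]
      simp only [hh, hg, hn, if_false, add_zero]
      ring
  rw [hterm] at hsum
  rw [hsum.unique ((hsg.mul_left (p : ℂ)).add hsh)]
  have hps : (p : ℂ) ^ s = p * p ^ (s - 1) := by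
    rw [← pow_succ']; congr 1; omega
  rw [hps]
  field_simp
  ring

end CotangentSeries

/-! ### The transformation law under $\tau\mapsto-1/\tau$. -/

section Transformation

open Complex

theorem hasSum_riemannZeta_natCast_succ {s : ℕ} (hs : 1 < s) :
    HasSum (fun n : ℕ => 1 / ((n : ℂ) + 1) ^ s) (riemannZeta s) := by
  have h := hasSum_riemannZeta_natCast hs
  rw [← hasSum_nat_add_iff' 1] at h
  simpa [show s ≠ 0 by omega] using h

theorem pi_mul_cot_pi_eq_tsum {z : ℂ} (hz : 0 < z.im) :
    Real.pi * cot (Real.pi * z) = 1 / z + 2 * z * ∑' m : ℕ, 1 / (z ^ 2 - ((m : ℂ) + 1) ^ 2) := by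
  have h := UpperHalfPlane.coe_mem_integerComplement ⟨z, hz⟩
  rw [← sub_eq_iff_eq_add', cot_series_rep' h, ← tsum_mul_left]
  refine tsum_congr fun m => ?_
  rw [← cotTerm, cotTerm_identity h]
  congr 2
  ring

/-- Multiplying by $\bar\tau$ makes the $a$-term real. The resulting lower bound depends on $b$
alone, which leaves the factor $n^{-2r}$ free to make the lattice sum converge in $n$. -/
theorem mul_im_le_norm_mul_sub {τ : ℂ} (a b : ℝ) :
    |b| * |τ.im| ≤ ‖τ‖ * ‖a * τ - b‖ := by
  have h : ‖τ‖ * ‖a * τ - b‖ = ‖(starRingEnd ℂ) τ * (a * τ - b)‖ := by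
    rw [norm_mul, RCLike.norm_conj]
  have h2 : ((starRingEnd ℂ) τ * (a * τ - b)).im = b * τ.im := by
    simp
    ring
  rw [h, ← abs_mul, ← h2]
  exact abs_im_le_norm _

/-- The lattice sum `∑ 1 / (n ^ (2 r) ((n τ) ^ 2 - m ^ 2))` converges absolutely. -/
theorem summable_one_div_pow_mul_sq_sub_sq {r : ℕ} (hr : 0 < r) {τ : ℂ} (hτ : 0 < τ.im) :
    Summable (fun x : ℕ × ℕ => 1 / ((x.1 : ℂ) + 1) ^ (2 * r) *
      (1 / ((((x.1 : ℂ) + 1) * τ) ^ 2 - ((x.2 : ℂ) + 1) ^ 2))) := by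
  have hτ0 : 0 < ‖τ‖ := norm_pos_iff.mpr (by rintro rfl; simp at hτ)
  have h1 : Summable (fun n : ℕ => 1 / ((n : ℝ) + 1) ^ (2 * r)) := by
    simpa using (summable_nat_add_iff 1).mpr
      (Real.summable_one_div_nat_pow.mpr (show 1 < 2 * r by omega))
  have h2 : Summable (fun n : ℕ => 1 / ((n : ℝ) + 1) ^ 2) := by
    simpa using (summable_nat_add_iff 1).mpr
      (Real.summable_one_div_nat_pow.mpr (show 1 < 2 by omega))
  have h3 := (h1.mul_of_nonneg h2 (fun n => by positivity) (fun n => by positivity)).mul_left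
    ((‖τ‖ / τ.im) ^ 2)
  refine Summable.of_norm_bounded h3 fun x => ?_
  have key : ∀ a b : ℝ, 0 < b → b * (τ.im / ‖τ‖) ≤ ‖a * τ - b‖ := by
    intro a b hb
    have := mul_im_le_norm_mul_sub (τ := τ) a b
    rw [abs_of_pos hb, abs_of_pos hτ] at this
    rw [mul_div_assoc', div_le_iff₀ hτ0]
    linarith
  have e1 := key (x.1 + 1) (x.2 + 1) (by positivity)
  -- The sign change of $a$ covers the other factor, $n\tau+m$.
  have e2 := key (-(x.1 + 1)) (x.2 + 1) (by positivity)
  have e3 : ((((x.1 : ℂ) + 1) * τ) ^ 2 - ((x.2 : ℂ) + 1) ^ 2) =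
      -((((x.1 + 1 : ℝ) : ℂ) * τ - ((x.2 + 1 : ℝ) : ℂ)) *
        (((-(x.1 + 1) : ℝ) : ℂ) * τ - ((x.2 + 1 : ℝ) : ℂ))) := by
    push_cast
    ring
  have e4 : (((x.2 : ℝ) + 1) * (τ.im / ‖τ‖)) ^ 2 ≤
      ‖(((x.1 : ℂ) + 1) * τ) ^ 2 - ((x.2 : ℂ) + 1) ^ 2‖ := by
    rw [e3, norm_neg, norm_mul, sq]
    exact mul_le_mul e1 e2 (by positivity) (norm_nonneg _)
  rw [norm_mul, norm_div, norm_div, norm_one, norm_pow,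
    show ‖(x.1 : ℂ) + 1‖ = (x.1 : ℝ) + 1 by exact_mod_cast Complex.norm_natCast (x.1 + 1)]
  calc 1 / ((x.1 : ℝ) + 1) ^ (2 * r) * (1 / ‖(((x.1 : ℂ) + 1) * τ) ^ 2 - ((x.2 : ℂ) + 1) ^ 2‖)
      ≤ 1 / ((x.1 : ℝ) + 1) ^ (2 * r) * (1 / (((x.2 : ℝ) + 1) * (τ.im / ‖τ‖)) ^ 2) := by
        gcongr
    _ = _ := by
        field_simp

/-- Termwise partial fractions of the cotangent: the pole $1/(n\tau)$ produces $\zeta(2r+2)/\tau$,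
and the factor $2n\tau$ lowers the exponent $2r+1$ to $2r$. -/
theorem pi_mul_cotSum {r : ℕ} (hr : 0 < r) {τ : ℂ} (hτ : 0 < τ.im) :
    Real.pi * cotSum (2 * r + 1) τ = I * (riemannZeta (2 * r + 2 : ℕ) / τ +
      2 * τ * ∑' x : ℕ × ℕ, 1 / ((x.1 : ℂ) + 1) ^ (2 * r) *
        (1 / ((((x.1 : ℂ) + 1) * τ) ^ 2 - ((x.2 : ℂ) + 1) ^ 2))) := by
  have hs := summable_one_div_pow_mul_sq_sub_sq hr hτ
  have h1 := hs.hasSum.prod_fiberwise fun n => (hs.prod_factor n).hasSum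
  have h2 := hasSum_riemannZeta_natCast_succ (show 1 < 2 * r + 2 by omega)
  have h3 := (((h2.div_const τ).add (h1.mul_left (2 * τ))).mul_left I)
  have h4 := (hasSum_cot_div_pow (show 1 < 2 * r + 1 by omega) hτ).summable.hasSum
  rw [← cotSum, ← hasSum_nat_add_iff' 1] at h4
  have h5 := h4.mul_left (Real.pi : ℂ)
  have hτ0 : τ ≠ 0 := by rintro rfl; simp at hτ
  simp only [Finset.sum_range_one, Nat.cast_zero, ne_eq, Nat.add_eq_zero_iff, one_ne_zero,
    and_false, not_false_eq_true, zero_pow, div_zero, sub_zero] at h5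
  refine h5.unique ?_
  convert h3 using 1
  funext n
  have hn : ((n : ℂ) + 1) ≠ 0 := by exact_mod_cast n.succ_ne_zero
  have h6 := pi_mul_cot_pi_eq_tsum (natCast_mul_im_pos n.succ_pos hτ)
  dsimp only
  rw [tsum_mul_left]
  push_cast at h6 ⊢
  rw [show Real.pi * (I * cot (Real.pi * ((n + 1) * τ)) / ((n : ℂ) + 1) ^ (2 * r + 1)) =
    I * (Real.pi * cot (Real.pi * ((n + 1) * τ))) / ((n : ℂ) + 1) ^ (2 * r + 1) by ring, h6]
  generalize ∑' m : ℕ, 1 / ((((n : ℂ) + 1) * τ) ^ 2 - ((m : ℂ) + 1) ^ 2) = A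
  field_simp
  ring

/-- The factorisation of $X^r-Y^r$ with $X=(n\tau)^2$, $Y=m^2$ cancels the denominator $X-Y$. What
remains separates in $n$ and $m$, hence sums to products of zeta values. -/
theorem sum_pow_mul_pow_mul_sq_sub_sq (r : ℕ) {n m τ : ℂ} (hn : n ≠ 0) (hm : m ≠ 0)
    (h : (n * τ) ^ 2 - m ^ 2 ≠ 0) :
    1 / n ^ (2 * r) * (1 / ((n * τ) ^ 2 - m ^ 2)) -
        τ ^ (2 * r) * (1 / m ^ (2 * r) * (1 / ((n * τ) ^ 2 - m ^ 2))) =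
      -∑ l ∈ Finset.range r, τ ^ (2 * l) * (1 / n ^ (2 * r - 2 * l) * (1 / m ^ (2 * l + 2))) := by
  have h1 := geom_sum₂_mul ((n * τ) ^ 2) (m ^ 2) r
  have h2 : ∀ l ∈ Finset.range r,
      τ ^ (2 * l) * (1 / n ^ (2 * r - 2 * l) * (1 / m ^ (2 * l + 2))) =
      ((n * τ) ^ 2) ^ l * (m ^ 2) ^ (r - 1 - l) / (n ^ (2 * r) * m ^ (2 * r)) := by
    intro l hl
    have hl' : l < r := Finset.mem_range.mp hl
    obtain ⟨d, rfl⟩ : ∃ d, r = l + 1 + d := ⟨r - (l + 1), by omega⟩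
    rw [show 2 * (l + 1 + d) - 2 * l = 2 + 2 * d by omega, show l + 1 + d - 1 - l = d by omega]
    field_simp
    ring
  rw [Finset.sum_congr rfl h2, ← Finset.sum_div, eq_neg_iff_add_eq_zero,
    eq_div_of_mul_eq h h1]
  field_simp
  ring

theorem neg_one_div_im_pos {τ : ℂ} (hτ : 0 < τ.im) : 0 < (-1 / τ).im := by
  have hτ0 : τ ≠ 0 := by rintro rfl; simp at hτ
  have : 0 < normSq τ := normSq_pos.mpr hτ0
  rw [neg_div, one_div, neg_im, inv_im]
  field_simp
  simpa using hτ

theorem natCast_add_one_mul_sq_sub_sq_ne_zero {τ : ℂ} (hτ : 0 < τ.im) (n m : ℕ) :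
    (((n : ℂ) + 1) * τ) ^ 2 - ((m : ℂ) + 1) ^ 2 ≠ 0 := by
  intro h
  have him := natCast_mul_im_pos n.succ_pos hτ
  rcases sq_eq_sq_iff_eq_or_eq_neg.mp (sub_eq_zero.mp h) with h | h
  all_goals
    have h1 := congrArg im h
    push_cast at him
    rw [h1] at him
    simp at him

theorem tsum_lattice_sub_pow_mul_tsum_lattice {r : ℕ} (hr : 0 < r) {τ : ℂ} (hτ : 0 < τ.im) :
    (∑' x : ℕ × ℕ, 1 / ((x.1 : ℂ) + 1) ^ (2 * r) *
        (1 / ((((x.1 : ℂ) + 1) * τ) ^ 2 - ((x.2 : ℂ) + 1) ^ 2))) +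
      τ ^ (2 * r) * ((1 / τ ^ 2) * ∑' x : ℕ × ℕ, 1 / ((x.1 : ℂ) + 1) ^ (2 * r) *
        (1 / ((((x.1 : ℂ) + 1) * (-1 / τ)) ^ 2 - ((x.2 : ℂ) + 1) ^ 2))) =
      -∑ l ∈ Finset.range r, τ ^ (2 * l) *
        (riemannZeta (2 * r - 2 * l : ℕ) * riemannZeta (2 * l + 2 : ℕ)) := by
  have hτ0 : τ ≠ 0 := by rintro rfl; simp at hτ
  have hs := (summable_one_div_pow_mul_sq_sub_sq hr hτ).hasSum
  -- Absolute convergence permits exchanging $n$ and $m$ in the sum at $-1/\tau$; its denominators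
  -- then become $-\tau^{-2}$ times those of the sum at $\tau$.
  have hs' := (Equiv.prodComm ℕ ℕ).hasSum_iff.mpr
    (summable_one_div_pow_mul_sq_sub_sq hr (neg_one_div_im_pos hτ)).hasSum
  have hdiff := hs.add ((hs'.mul_left (1 / τ ^ 2)).mul_left (τ ^ (2 * r)))
  have hzeta : HasSum (fun x : ℕ × ℕ => -∑ l ∈ Finset.range r, τ ^ (2 * l) *
      (1 / ((x.1 : ℂ) + 1) ^ (2 * r - 2 * l) * (1 / ((x.2 : ℂ) + 1) ^ (2 * l + 2))))
      (-∑ l ∈ Finset.range r, τ ^ (2 * l) *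
        (riemannZeta (2 * r - 2 * l : ℕ) * riemannZeta (2 * l + 2 : ℕ))) := by
    refine (hasSum_sum fun l hl => ?_).neg
    have hl' : l < r := Finset.mem_range.mp hl
    have h1 := hasSum_riemannZeta_natCast_succ (show 1 < 2 * r - 2 * l by omega)
    have h2 := hasSum_riemannZeta_natCast_succ (show 1 < 2 * l + 2 by omega)
    have h3 := summable_mul_of_summable_norm h1.summable.norm h2.summable.norm
    have h4 := (h1.mul h2 h3).mul_left (τ ^ (2 * l))
    exact h4
  suffices h : ∀ x : ℕ × ℕ, 1 / ((x.1 : ℂ) + 1) ^ (2 * r) *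
        (1 / ((((x.1 : ℂ) + 1) * τ) ^ 2 - ((x.2 : ℂ) + 1) ^ 2)) +
      τ ^ (2 * r) * ((1 / τ ^ 2) * (1 / ((x.2 : ℂ) + 1) ^ (2 * r) *
        (1 / ((((x.2 : ℂ) + 1) * (-1 / τ)) ^ 2 - ((x.1 : ℂ) + 1) ^ 2)))) =
      -∑ l ∈ Finset.range r, τ ^ (2 * l) *
        (1 / ((x.1 : ℂ) + 1) ^ (2 * r - 2 * l) * (1 / ((x.2 : ℂ) + 1) ^ (2 * l + 2))) by
    rw [← funext h] at hzeta
    exact hdiff.unique hzeta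
  intro x
  have hn : ((x.1 : ℂ) + 1) ≠ 0 := by exact_mod_cast x.1.succ_ne_zero
  have hm : ((x.2 : ℂ) + 1) ≠ 0 := by exact_mod_cast x.2.succ_ne_zero
  have hne := natCast_add_one_mul_sq_sub_sq_ne_zero hτ x.1 x.2
  rw [← sum_pow_mul_pow_mul_sq_sub_sq r hn hm hne]
  have h7 : (((x.2 : ℂ) + 1) * (-1 / τ)) ^ 2 - ((x.1 : ℂ) + 1) ^ 2 =
      -(1 / τ ^ 2) * ((((x.1 : ℂ) + 1) * τ) ^ 2 - ((x.2 : ℂ) + 1) ^ 2) := by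
    field_simp
    ring
  rw [h7]
  generalize (((x.1 : ℂ) + 1) * τ) ^ 2 - ((x.2 : ℂ) + 1) ^ 2 = y at hne
  field_simp
  ring

/-- The transformation law of the cotangent Dirichlet series under `τ ↦ -1 / τ`. -/
theorem cotSum_sub_pow_mul_cotSum_neg_inv {r : ℕ} (hr : 0 < r) {τ : ℂ} (hτ : 0 < τ.im) :
    Real.pi * (cotSum (2 * r + 1) τ - τ ^ (2 * r) * cotSum (2 * r + 1) (-1 / τ)) =
      I * (riemannZeta (2 * r + 2 : ℕ) * (1 / τ + τ ^ (2 * r + 1)) -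
        2 * ∑ l ∈ Finset.range r, τ ^ (2 * l + 1) *
          (riemannZeta (2 * r - 2 * l : ℕ) * riemannZeta (2 * l + 2 : ℕ))) := by
  have hτ0 : τ ≠ 0 := by rintro rfl; simp at hτ
  have hsum := tsum_lattice_sub_pow_mul_tsum_lattice hr hτ
  have e1 := pi_mul_cotSum hr hτ
  have e2 := pi_mul_cotSum hr (neg_one_div_im_pos hτ)
  have e3 : ∑ l ∈ Finset.range r, τ ^ (2 * l + 1) *
      (riemannZeta (2 * r - 2 * l : ℕ) * riemannZeta (2 * l + 2 : ℕ)) =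
      τ * ∑ l ∈ Finset.range r, τ ^ (2 * l) *
      (riemannZeta (2 * r - 2 * l : ℕ) * riemannZeta (2 * l + 2 : ℕ)) := by
    rw [Finset.mul_sum]
    exact Finset.sum_congr rfl fun l _ => by ring
  rw [mul_sub, mul_left_comm, e1, e2, e3]
  generalize (∑' x : ℕ × ℕ, 1 / ((x.1 : ℂ) + 1) ^ (2 * r) *
      (1 / ((((x.1 : ℂ) + 1) * (-1 / τ)) ^ 2 - ((x.2 : ℂ) + 1) ^ 2))) = A at hsum
  have e4 : τ ^ (2 * r) * (I * (riemannZeta (2 * r + 2 : ℕ) / (-1 / τ) + 2 * (-1 / τ) * A)) =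
      -I * riemannZeta (2 * r + 2 : ℕ) * τ ^ (2 * r + 1) -
        I * (2 * τ * (τ ^ (2 * r) * ((1 / τ ^ 2) * A))) := by
    field_simp
    ring
  rw [e4]
  linear_combination (2 * I * τ) * hsum

end Transformation

/-! ### The period function in terms of Bernoulli numbers. -/

noncomputable section

/-- `B_{2j} B_{4k + 2 - 2j} / ((2j)! (4k + 2 - 2j)!)`. -/
def bernoulliPair (k j : ℕ) : ℂ :=
  ((bernoulli (2 * j) : ℚ) : ℂ) * ((bernoulli (4 * k + 2 - 2 * j) : ℚ) : ℂ) /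
    (((2 * j).factorial : ℂ) * ((4 * k + 2 - 2 * j).factorial : ℂ))

/-- The contribution of the point `(i - n) / p` to `oddBracket`. -/
def gaussBracket (p : ℂ) (n : ℤ) (k j : ℕ) : ℂ :=
  p ^ (2 * (j : ℤ) - 1) * (1 + Complex.I * (n : ℂ)) ^ (4 * (k : ℤ) + 1 - 2 * j) -
    p ^ (4 * (k : ℤ) + 1 - 2 * j) * (1 + Complex.I * (n : ℂ)) ^ (2 * (j : ℤ) - 1)

end

section BernoulliForm

open Complex

theorem bernoulliPair_reflect {k j : ℕ} (hj : j ≤ 2 * k + 1) :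
    bernoulliPair k (2 * k + 1 - j) = bernoulliPair k j := by
  rw [bernoulliPair, bernoulliPair, show 2 * (2 * k + 1 - j) = 4 * k + 2 - 2 * j by omega,
    show 4 * k + 2 - (4 * k + 2 - 2 * j) = 2 * j by omega]
  ring

theorem bernoulliSum_eq (k : ℕ) (c : ℕ → ℂ) :
    bernoulliSum k c = ∑ j ∈ Finset.range (k + 1), (-1) ^ (j + 1) * c j * bernoulliPair k j := by
  refine Finset.sum_congr rfl fun j _ => ?_
  rw [bernoulliPair]
  ring

theorem bernoulliSum_add (k : ℕ) (c d : ℕ → ℂ) :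
    bernoulliSum k (fun j => c j + d j) = bernoulliSum k c + bernoulliSum k d := by
  simp only [bernoulliSum_eq, ← Finset.sum_add_distrib]
  exact Finset.sum_congr rfl fun j _ => by ring

theorem bernoulliSum_mul_left (k : ℕ) (a : ℂ) (c : ℕ → ℂ) :
    bernoulliSum k (fun j => a * c j) = a * bernoulliSum k c := by
  simp only [bernoulliSum_eq, Finset.mul_sum]
  exact Finset.sum_congr rfl fun j _ => by ring

theorem bernoulliSum_sub (k : ℕ) (c d : ℕ → ℂ) :
    bernoulliSum k (fun j => c j - d j) = bernoulliSum k c - bernoulliSum k d := by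
  simp only [bernoulliSum_eq, ← Finset.sum_sub_distrib]
  exact Finset.sum_congr rfl fun j _ => by ring

theorem bernoulliSum_sum {ι : Type*} (k : ℕ) (s : Finset ι) (c : ι → ℕ → ℂ) :
    bernoulliSum k (fun j => ∑ n ∈ s, c n j) = ∑ n ∈ s, bernoulliSum k (c n) := by
  simp only [bernoulliSum_eq, Finset.mul_sum, Finset.sum_mul]
  exact Finset.sum_comm

/-- Euler's formula for both factors. Their signs multiply to $-1$ for every $j$, since the two
half-arguments add up to the odd number $2k+1$. -/
theorem riemannZeta_mul_riemannZeta {k j : ℕ} (hj : 1 ≤ j) (hj' : j ≤ 2 * k) :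
    riemannZeta (2 * j : ℕ) * riemannZeta (4 * k + 2 - 2 * j : ℕ) =
      -((2 * Real.pi : ℂ) ^ (4 * k + 2) / 4) * bernoulliPair k j := by
  obtain ⟨i, rfl⟩ : ∃ i, j = i + 1 := ⟨j - 1, by omega⟩
  obtain ⟨d, hd⟩ : ∃ d, 2 * k + 1 - (i + 1) = d + 1 := ⟨2 * k - (i + 1), by omega⟩
  have h1 := riemannZeta_two_mul_nat (show i + 1 ≠ 0 by omega)
  have h2 := riemannZeta_two_mul_nat (show d + 1 ≠ 0 by omega)
  rw [bernoulliPair, show 4 * k + 2 - 2 * (i + 1) = 2 * (d + 1) by omega]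
  rw [Nat.cast_mul 2 (i + 1), Nat.cast_mul 2 (d + 1), Nat.cast_ofNat, h1, h2,
    show 4 * k + 2 = 2 * (i + 1) + 2 * (d + 1) by omega,
    show 2 * (i + 1) - 1 = 2 * i + 1 by omega, show 2 * (d + 1) - 1 = 2 * d + 1 by omega]
  have h3 : (-1 : ℂ) ^ (i + 1 + 1) * (-1) ^ (d + 1 + 1) = -1 := by
    rw [← pow_add, show i + 1 + 1 + (d + 1 + 1) = 2 * (k + 1) + 1 by omega, pow_succ, pow_mul]
    simp
  linear_combination ((2 : ℂ) ^ (2 * i + 1) * Real.pi ^ (2 * (i + 1)) *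
    bernoulli (2 * (i + 1)) / (2 * (i + 1)).factorial * ((2 : ℂ) ^ (2 * d + 1) *
    Real.pi ^ (2 * (d + 1)) * bernoulli (2 * (d + 1)) / (2 * (d + 1)).factorial)) * h3

theorem riemannZeta_four_mul_add_two (k : ℕ) :
    riemannZeta (4 * k + 2 : ℕ) = (2 * Real.pi : ℂ) ^ (4 * k + 2) / 2 * bernoulliPair k 0 := by
  have h1 := riemannZeta_two_mul_nat (show 2 * k + 1 ≠ 0 by omega)
  rw [show 4 * k + 2 = 2 * (2 * k + 1) by omega, Nat.cast_mul 2 (2 * k + 1), Nat.cast_ofNat, h1,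
    bernoulliPair, show 2 * (2 * k + 1) - 1 = 4 * k + 1 by omega,
    show 4 * k + 2 - 2 * 0 = 2 * (2 * k + 1) by omega, show 2 * k + 1 + 1 = 2 * (k + 1) by omega,
    pow_mul (-1 : ℂ)]
  simp
  ring

/-- The symmetry $j\leftrightarrow 2k+1-j$ folds the period function onto $0\le j\le k$, the range
used in $P_k$ and $P'_k$. -/
theorem sum_zpow_mul_bernoulliPair (k : ℕ) (τ : ℂ) :
    ∑ j ∈ Finset.range (2 * k + 2), τ ^ (2 * (j : ℤ) - 1) * bernoulliPair k j =
      ∑ j ∈ Finset.range (k + 1),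
        (τ ^ (2 * (j : ℤ) - 1) + τ ^ (4 * (k : ℤ) + 1 - 2 * j)) * bernoulliPair k j := by
  rw [show 2 * k + 2 = (k + 1) + (k + 1) by omega, Finset.sum_range_add]
  conv_lhs => rw [← Finset.sum_range_reflect (fun j => τ ^ (2 * ((k + 1 + j : ℕ) : ℤ) - 1) *
    bernoulliPair k (k + 1 + j))]
  rw [← Finset.sum_add_distrib]
  refine Finset.sum_congr rfl fun j hj => ?_
  have hj' : j ≤ k := Nat.lt_succ_iff.mp (Finset.mem_range.mp hj)
  have h1 : k + 1 + (k + 1 - 1 - j) = 2 * k + 1 - j := by omega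
  rw [h1, bernoulliPair_reflect (by omega), ← add_mul,
    show 2 * ((2 * k + 1 - j : ℕ) : ℤ) - 1 = 4 * (k : ℤ) + 1 - 2 * j by omega]

/-- The transformation law with $r=2k$. The $\zeta(4k+2)$ term supplies exactly the end terms $j=0$
and $j=2k+1$ of one uniform Bernoulli sum. -/
theorem cotSum_eq_pow_mul_cotSum_add {k : ℕ} (hk : 0 < k) {τ : ℂ} (hτ : 0 < τ.im) :
    cotSum (4 * k + 1) τ = τ ^ (4 * k) * cotSum (4 * k + 1) (-1 / τ) +
      I * (2 * Real.pi) ^ (4 * k + 1) * ∑ j ∈ Finset.range (k + 1),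
        (τ ^ (2 * (j : ℤ) - 1) + τ ^ (4 * (k : ℤ) + 1 - 2 * j)) * bernoulliPair k j := by
  have hτ0 : τ ≠ 0 := by rintro rfl; simp at hτ
  have hπ : (Real.pi : ℂ) ≠ 0 := ofReal_ne_zero.mpr Real.pi_ne_zero
  have h := cotSum_sub_pow_mul_cotSum_neg_inv (show 0 < 2 * k by omega) hτ
  have h1 : ∀ l ∈ Finset.range (2 * k), τ ^ (2 * l + 1) *
      (riemannZeta (2 * (2 * k) - 2 * l : ℕ) * riemannZeta (2 * l + 2 : ℕ)) =
      -((2 * Real.pi : ℂ) ^ (4 * k + 2) / 4) *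
        (τ ^ (2 * ((l + 1 : ℕ) : ℤ) - 1) * bernoulliPair k (l + 1)) := by
    intro l hl
    have hl' := Finset.mem_range.mp hl
    have h2 := riemannZeta_mul_riemannZeta (show 1 ≤ l + 1 by omega) (show l + 1 ≤ 2 * k by omega)
    rw [show 2 * (l + 1) = 2 * l + 2 by omega,
      show 4 * k + 2 - (2 * l + 2) = 2 * (2 * k) - 2 * l by omega] at h2
    rw [show 2 * ((l + 1 : ℕ) : ℤ) - 1 = ((2 * l + 1 : ℕ) : ℤ) by push_cast; ring, zpow_natCast,
      mul_comm (riemannZeta _), h2]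
    ring
  rw [Finset.sum_congr rfl h1, ← Finset.mul_sum, show 2 * (2 * k) = 4 * k by omega,
    riemannZeta_four_mul_add_two] at h
  rw [← sum_zpow_mul_bernoulliPair, Finset.sum_range_succ, Finset.sum_range_succ']
  have h3 : bernoulliPair k (2 * k + 1) = bernoulliPair k 0 :=
    bernoulliPair_reflect (j := 0) (by omega)
  rw [h3, show 2 * ((2 * k + 1 : ℕ) : ℤ) - 1 = ((4 * k + 1 : ℕ) : ℤ) by push_cast; ring,
    zpow_natCast, show 2 * ((0 : ℕ) : ℤ) - 1 = -1 by simp, zpow_neg_one]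
  refine mul_left_cancel₀ hπ ?_
  rw [← sub_eq_zero] at h ⊢
  rw [← h]
  ring

theorem I_mul_zpow_add_zpow (k j : ℕ) (z : ℂ) :
    I * ((I * z) ^ (2 * (j : ℤ) - 1) + (I * z) ^ (4 * (k : ℤ) + 1 - 2 * j)) =
      (-1) ^ (j + 1) * (z ^ (4 * (k : ℤ) + 1 - 2 * j) - z ^ (2 * (j : ℤ) - 1)) := by
  have h1 : I * I ^ (2 * (j : ℤ) - 1) = (-1) ^ j := by
    rw [← zpow_one_add₀ I_ne_zero, show 1 + (2 * (j : ℤ) - 1) = ((2 * j : ℕ) : ℤ) by push_cast; ring,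
      zpow_natCast, pow_mul, I_sq]
  have h2 : I * I ^ (4 * (k : ℤ) + 1 - 2 * j) = -(-1) ^ j := by
    rw [← zpow_one_add₀ I_ne_zero,
      show 1 + (4 * (k : ℤ) + 1 - 2 * j) = 2 * (2 * k + 1 - j) by ring, zpow_mul,
      show I ^ (2 : ℤ) = -1 by rw [zpow_ofNat, I_sq], zpow_sub₀ (by norm_num), zpow_natCast,
      show (2 * (k : ℤ) + 1) = ((2 * k + 1 : ℕ) : ℤ) by push_cast; ring, zpow_natCast, pow_succ,
      pow_mul]
    rcases neg_one_pow_eq_or ℂ j with h | h <;> simp [h]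
  rw [mul_zpow, mul_zpow, mul_add, ← mul_assoc, ← mul_assoc, h1, h2]
  ring

theorem one_add_I_mul_intCast_ne_zero (n : ℤ) : 1 + I * (n : ℂ) ≠ 0 := by
  intro h
  simpa using congrArg re h

/-- Inversion at $\tau=i(1+in)/p$. Since $i^{4k}=1$, the automorphy factor is $(1+in)^{4k}/p^{4k}$;
this is where the exponent $4k+1$ matters. -/
theorem pow_mul_cotSum_I_sub_div {k : ℕ} (hk : 0 < k) {p : ℕ} (hp : 0 < p) (n : ℤ) :
    (p : ℂ) ^ (4 * k) * cotSum (4 * k + 1) ((I - n) / p) =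
      (1 + I * n) ^ (4 * k) * cotSum (4 * k + 1) (p * (I + n) / (1 + n ^ 2)) +
        (2 * Real.pi) ^ (4 * k + 1) * bernoulliSum k (gaussBracket p n k) := by
  have hp0 : (p : ℂ) ≠ 0 := by exact_mod_cast hp.ne'
  have hn := one_add_I_mul_intCast_ne_zero n
  have hn' : (1 : ℂ) + n ^ 2 ≠ 0 := by
    have : (0 : ℝ) < 1 + (n : ℝ) ^ 2 := by positivity
    exact_mod_cast this.ne'
  have hτ : (I - n) / p = I * ((1 + I * n) / p) := by
    rw [mul_div_assoc', mul_add, ← mul_assoc, I_mul_I]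
    ring
  have him : 0 < ((I - n) / p : ℂ).im := by
    rw [div_natCast_im]
    simpa using hp
  have hinv : -1 / ((I - n) / p : ℂ) = p * (I + n) / (1 + n ^ 2) := by
    have h0 : I - (n : ℂ) ≠ 0 := by
      intro h
      simpa using congrArg im h
    field_simp
    linear_combination -I_sq
  have hpow : ((I - n) / p : ℂ) ^ (4 * k) = (1 + I * n) ^ (4 * k) / (p : ℂ) ^ (4 * k) := by
    rw [hτ, mul_pow, pow_mul I, I_pow_four, one_pow, one_mul, div_pow]
  rw [cotSum_eq_pow_mul_cotSum_add hk him, hinv, hpow, mul_add]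
  congr 1
  · field_simp
  · have e0 : ∀ a b c : ℂ, a * (I * b * c) = b * (a * (I * c)) := fun a b c => by ring
    rw [hτ, bernoulliSum_eq, e0, Finset.mul_sum _ _ I, Finset.mul_sum]
    congr 1
    refine Finset.sum_congr rfl fun j _ => ?_
    rw [← mul_assoc I, I_mul_zpow_add_zpow, gaussBracket, div_zpow, div_zpow]
    have e1 : (p : ℂ) ^ (4 * k) =
        (p : ℂ) ^ (2 * (j : ℤ) - 1) * (p : ℂ) ^ (4 * (k : ℤ) + 1 - 2 * j) := by
      rw [← zpow_add₀ hp0, ← zpow_natCast]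
      congr 1
      push_cast
      ring
    have e2 := zpow_ne_zero (2 * (j : ℤ) - 1) hp0
    have e3 := zpow_ne_zero (4 * (k : ℤ) + 1 - 2 * j) hp0
    rw [e1]
    field_simp

theorem oddBracket_eq_sum (p : ℂ) (h : ℤ) (k : ℕ) :
    oddBracket p h k = fun j => ∑ n ∈ Finset.Icc (-h) h, gaussBracket p n k j := by
  funext j
  simp only [oddBracket, gaussianPowerSum, gaussBracket, Finset.mul_sum, Finset.sum_sub_distrib]

theorem two_pow_mul_twoBracket (k : ℕ) :
    (fun j => (2 : ℂ) ^ (4 * k) * twoBracket k j) =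
      fun j => gaussBracket 2 0 k j + gaussBracket 2 1 k j := by
  funext j
  have e1 : (2 : ℂ) ^ (4 * k) =
      (2 : ℂ) ^ (2 * (j : ℤ) - 1) * (2 : ℂ) ^ (4 * (k : ℤ) + 1 - 2 * j) := by
    rw [← zpow_add₀ two_ne_zero, ← zpow_natCast]
    congr 1
    push_cast
    ring
  have e2 := zpow_ne_zero (2 * (j : ℤ) - 1) (two_ne_zero (α := ℂ))
  have e3 := zpow_ne_zero (4 * (k : ℤ) + 1 - 2 * j) (two_ne_zero (α := ℂ))
  rw [twoBracket, gaussBracket, gaussBracket, e1]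
  simp only [Int.cast_zero, mul_zero, add_zero, one_zpow, Int.cast_one, mul_one]
  field_simp
  ring

end BernoulliForm

/-! ### The Hecke relations at $\tau=i$ for $p=2,3,5$. -/

section ZetaFormulas

open Complex

theorem one_add_I_pow_four_mul (k : ℕ) : (1 + I) ^ (4 * k) = (-1) ^ k * 2 ^ (2 * k) := by
  rw [pow_mul, pow_mul, ← mul_pow]
  congr 1
  linear_combination (I ^ 2 + 4 * I + 5) * I_sq

theorem one_sub_I_pow_four_mul (k : ℕ) : (1 - I) ^ (4 * k) = (-1) ^ k * 2 ^ (2 * k) := by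
  rw [pow_mul, pow_mul, ← mul_pow]
  congr 1
  linear_combination (I ^ 2 - 4 * I + 5) * I_sq

/-- Polar form $1\pm2i=\sqrt5\,e^{\pm i\arctan 2}$. -/
theorem one_add_two_I_pow_four_mul_add (k : ℕ) :
    (1 + 2 * I) ^ (4 * k) + (1 - 2 * I) ^ (4 * k) =
      2 * 5 ^ (2 * k) * ((Real.cos (4 * k * Real.arctan 2) : ℝ) : ℂ) := by
  have h5 : (Real.sqrt 5) ^ 2 = 5 := Real.sq_sqrt (by norm_num)
  have h50 : Real.sqrt 5 ≠ 0 := by positivity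
  have h1 : ((Real.cos (Real.arctan 2) : ℝ) : ℂ) = 1 / (Real.sqrt 5 : ℂ) := by
    rw [Real.cos_arctan]
    norm_num
  have h2 : ((Real.sin (Real.arctan 2) : ℝ) : ℂ) = 2 / (Real.sqrt 5 : ℂ) := by
    rw [Real.sin_arctan]
    norm_num
  have h5c : (Real.sqrt 5 : ℂ) ^ 2 = 5 := by exact_mod_cast h5
  have h50c : (Real.sqrt 5 : ℂ) ≠ 0 := by exact_mod_cast h50
  have hpow : (Real.sqrt 5 : ℂ) ^ (4 * k) = 5 ^ (2 * k) := by
    rw [show 4 * k = 2 * (2 * k) by ring, pow_mul, h5c]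
  have e1 : 1 + 2 * I = Real.sqrt 5 * exp (Real.arctan 2 * I) := by
    rw [exp_mul_I, ← ofReal_cos, ← ofReal_sin, h1, h2]
    field_simp
  have e2 : 1 - 2 * I = Real.sqrt 5 * exp (-Real.arctan 2 * I) := by
    rw [exp_mul_I, cos_neg, sin_neg, ← ofReal_cos, ← ofReal_sin, h1, h2]
    field_simp
    ring
  rw [e1, e2, mul_pow, mul_pow, hpow, ← exp_nat_mul, ← exp_nat_mul, ofReal_cos, Complex.cos,
    ofReal_mul]
  generalize (Real.arctan 2 : ℂ) = θ
  push_cast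
  rw [show 4 * (k : ℂ) * (-θ * I) = -(4 * k * θ) * I by ring,
    show 4 * (k : ℂ) * (θ * I) = (4 * k * θ) * I by ring]
  ring

theorem cotSum_eq_of_eq_add_intCast {s : ℕ} (hs : 1 < s) {τ τ' : ℂ} (hτ : 0 < τ'.im) (m : ℤ)
    (h : τ = τ' + m) : cotSum s τ = cotSum s τ' :=
  h ▸ cotSum_add_intCast hs hτ m

theorem exp_two_pi_I_mul_natCast_mul_I (m : ℕ) :
    exp (2 * Real.pi * I * (m * I)) = expPi (2 * m) := by
  rw [expPi, ofReal_exp]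
  congr 1
  push_cast
  linear_combination (2 * Real.pi * m : ℂ) * I_sq

theorem exp_two_pi_I_mul_half (m : ℕ) :
    exp (2 * Real.pi * I * ((1 + m * I) / 2)) = -expPi m := by
  rw [expPi, ofReal_exp, ← neg_one_mul, ← exp_pi_mul_I, ← exp_add]
  congr 1
  push_cast
  linear_combination (Real.pi * m : ℂ) * I_sq

theorem cotSum_natCast_mul_I {k : ℕ} (hk : 0 < k) {m : ℕ} (hm : 0 < m) :
    cotSum (4 * k + 1) (m * I) =
      riemannZeta (4 * (k : ℂ) + 1) + 2 * lambertL (expPi (2 * m)) (-4 * (k : ℂ) - 1) := by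
  rw [cotSum_eq (by omega) (by simpa using hm), exp_two_pi_I_mul_natCast_mul_I]
  push_cast
  ring_nf

theorem cotSum_half {k : ℕ} (hk : 0 < k) {m : ℕ} (hm : 0 < m) :
    cotSum (4 * k + 1) ((1 + m * I) / 2) =
      riemannZeta (4 * (k : ℂ) + 1) + 2 * lambertL (-expPi m) (-4 * (k : ℂ) - 1) := by
  rw [cotSum_eq (by omega) (by simpa using hm), exp_two_pi_I_mul_half]
  push_cast
  ring_nf

/-- $C(2i)$ arises twice, from $p\tau$ and from $b=0$. The point $(i+1)/2$ returns to $i$ with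
factor $(1+i)^{4k}=(-4)^k$, which is moved to the right-hand side. -/
theorem cotSum_hecke_two {k : ℕ} (hk : 0 < k) :
    2 * cotSum (4 * k + 1) (2 * I) +
        (2 * Real.pi) ^ (4 * k + 1) * (2 ^ (4 * k) * bernoulliSum k (twoBracket k)) =
      (2 ^ (4 * k + 1) - (-1) ^ k * 2 ^ (2 * k) + 1) * cotSum (4 * k + 1) I := by
  have hs : 1 < 4 * k + 1 := by omega
  have h := cotSum_hecke hs Nat.prime_two (τ := I) (by simp)
  have h0 := pow_mul_cotSum_I_sub_div hk (p := 2) (by norm_num) 0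
  have h1 := pow_mul_cotSum_I_sub_div hk (p := 2) (by norm_num) 1
  have e1 : cotSum (4 * k + 1) ((I + 1) / 2) = cotSum (4 * k + 1) ((I - 1) / 2) :=
    cotSum_eq_of_eq_add_intCast hs (by simp) 1 (by push_cast; ring)
  have e2 : cotSum (4 * k + 1) (2 * (I + 1) / (1 + 1 ^ 2)) = cotSum (4 * k + 1) I :=
    cotSum_eq_of_eq_add_intCast hs (by simp) 1 (by push_cast; ring)
  simp only [Nat.cast_ofNat, Finset.sum_range_succ, Finset.sum_range_zero, Nat.cast_zero,
    Nat.cast_one, Int.cast_zero, Int.cast_one, add_zero, zero_add, sub_zero, mul_zero, mul_one,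
    one_pow, one_mul, Nat.add_sub_cancel, ne_eq, OfNat.ofNat_ne_zero, not_false_eq_true, zero_pow,
    div_one, one_add_I_pow_four_mul] at h h0 h1 e2
  rw [← bernoulliSum_mul_left, two_pow_mul_twoBracket, bernoulliSum_add]
  rw [e2] at h1
  rw [e1] at h
  linear_combination h - h0 - h1

theorem cotSum_hecke_three {k : ℕ} (hk : 0 < k) :
    2 * cotSum (4 * k + 1) (3 * I) +
        2 * ((-1) ^ k * 2 ^ (2 * k)) * cotSum (4 * k + 1) ((1 + 3 * I) / 2) +
        (2 * Real.pi) ^ (4 * k + 1) * bernoulliSum k (oddBracket 3 1 k) =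
      (3 ^ (4 * k + 1) + 1) * cotSum (4 * k + 1) I := by
  have hs : 1 < 4 * k + 1 := by omega
  have h := cotSum_hecke hs Nat.prime_three (τ := I) (by simp)
  have h0 := pow_mul_cotSum_I_sub_div hk (p := 3) (by norm_num) 0
  have h1 := pow_mul_cotSum_I_sub_div hk (p := 3) (by norm_num) 1
  have h2 := pow_mul_cotSum_I_sub_div hk (p := 3) (by norm_num) (-1)
  -- Symmetric representatives modulo $p$ are used, so that conjugate Gaussian integers $1\pm in$
  -- are paired.
  have e1 : cotSum (4 * k + 1) ((I + 2) / 3) = cotSum (4 * k + 1) ((I - 1) / 3) :=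
    cotSum_eq_of_eq_add_intCast hs (by simp) 1 (by push_cast; ring)
  have e2 : cotSum (4 * k + 1) (3 * (I + 1) / (1 + 1 ^ 2)) =
      cotSum (4 * k + 1) ((1 + 3 * I) / 2) :=
    cotSum_eq_of_eq_add_intCast hs (by simp) 1 (by push_cast; ring)
  have e3 : cotSum (4 * k + 1) (3 * (I + -1) / (1 + (-1) ^ 2)) =
      cotSum (4 * k + 1) ((1 + 3 * I) / 2) :=
    cotSum_eq_of_eq_add_intCast hs (by simp) (-2) (by push_cast; ring)
  have e4 : Finset.Icc (-1 : ℤ) 1 = {0, 1, -1} := by decide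
  simp only [Nat.cast_ofNat, Finset.sum_range_succ, Finset.sum_range_zero, Nat.cast_zero,
    Nat.cast_one, Int.cast_zero, Int.cast_one, Int.cast_neg, add_zero, zero_add, sub_zero,
    sub_neg_eq_add, mul_zero, mul_one, mul_neg, ← sub_eq_add_neg, even_two, Even.neg_pow,
    one_pow, one_mul, Nat.add_sub_cancel, ne_eq, OfNat.ofNat_ne_zero, not_false_eq_true, zero_pow,
    div_one, one_add_I_pow_four_mul, one_sub_I_pow_four_mul] at h h0 h1 h2 e2 e3
  rw [oddBracket_eq_sum, bernoulliSum_sum, e4, Finset.sum_insert (by decide),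
    Finset.sum_insert (by decide), Finset.sum_singleton]
  rw [e2] at h1
  rw [e3] at h2
  rw [e1] at h
  linear_combination h - h0 - h1 - h2

/-- Because $1+2^2=5$, the points with $n=\pm2$ invert to $i\pm2$, hence return to $i$; their
factors $(1\pm2i)^{4k}$ create the cosine. The points with $n=\pm1$ go to $(1+5i)/2$ up to
translation. -/
theorem cotSum_hecke_five {k : ℕ} (hk : 0 < k) :
    2 * cotSum (4 * k + 1) (5 * I) +
        2 * ((-1) ^ k * 2 ^ (2 * k)) * cotSum (4 * k + 1) ((1 + 5 * I) / 2) +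
        (2 * Real.pi) ^ (4 * k + 1) * bernoulliSum k (oddBracket 5 2 k) =
      (5 ^ (4 * k + 1) - 2 * 5 ^ (2 * k) * ((Real.cos (4 * k * Real.arctan 2) : ℝ) : ℂ) + 1) *
        cotSum (4 * k + 1) I := by
  have hs : 1 < 4 * k + 1 := by omega
  have h := cotSum_hecke hs Nat.prime_five (τ := I) (by simp)
  have h0 := pow_mul_cotSum_I_sub_div hk (p := 5) (by norm_num) 0
  have h1 := pow_mul_cotSum_I_sub_div hk (p := 5) (by norm_num) 1
  have h2 := pow_mul_cotSum_I_sub_div hk (p := 5) (by norm_num) (-1)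
  have h3 := pow_mul_cotSum_I_sub_div hk (p := 5) (by norm_num) 2
  have h4 := pow_mul_cotSum_I_sub_div hk (p := 5) (by norm_num) (-2)
  have e1 : cotSum (4 * k + 1) ((I + 4) / 5) = cotSum (4 * k + 1) ((I - 1) / 5) :=
    cotSum_eq_of_eq_add_intCast hs (by simp) 1 (by push_cast; ring)
  have e1' : cotSum (4 * k + 1) ((I + 3) / 5) = cotSum (4 * k + 1) ((I - 2) / 5) :=
    cotSum_eq_of_eq_add_intCast hs (by simp) 1 (by push_cast; ring)
  have e2 : cotSum (4 * k + 1) (5 * (I + 1) / (1 + 1 ^ 2)) =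
      cotSum (4 * k + 1) ((1 + 5 * I) / 2) :=
    cotSum_eq_of_eq_add_intCast hs (by simp) 2 (by push_cast; ring)
  have e3 : cotSum (4 * k + 1) (5 * (I + -1) / (1 + (-1) ^ 2)) =
      cotSum (4 * k + 1) ((1 + 5 * I) / 2) :=
    cotSum_eq_of_eq_add_intCast hs (by simp) (-3) (by push_cast; ring)
  have e5 : cotSum (4 * k + 1) (5 * (I + 2) / (1 + 2 ^ 2)) = cotSum (4 * k + 1) I :=
    cotSum_eq_of_eq_add_intCast hs (by simp) 2 (by push_cast; ring)
  have e6 : cotSum (4 * k + 1) (5 * (I + -2) / (1 + (-2) ^ 2)) = cotSum (4 * k + 1) I :=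
    cotSum_eq_of_eq_add_intCast hs (by simp) (-2) (by push_cast; ring)
  have e4 : Finset.Icc (-2 : ℤ) 2 = {0, 1, -1, 2, -2} := by decide
  simp only [Nat.cast_ofNat, Finset.sum_range_succ, Finset.sum_range_zero, Nat.cast_zero,
    Nat.cast_one, Int.cast_zero, Int.cast_one, Int.cast_neg, Int.cast_ofNat, add_zero, zero_add,
    sub_zero, sub_neg_eq_add, mul_zero, mul_one, mul_neg, ← sub_eq_add_neg, even_two, Even.neg_pow,
    one_pow, one_mul, Nat.add_sub_cancel, ne_eq, OfNat.ofNat_ne_zero, not_false_eq_true, zero_pow,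
    div_one, one_add_I_pow_four_mul, one_sub_I_pow_four_mul, mul_comm I 2]
    at h h0 h1 h2 h3 h4 e2 e3 e5 e6
  rw [oddBracket_eq_sum, bernoulliSum_sum, e4, Finset.sum_insert (by decide),
    Finset.sum_insert (by decide), Finset.sum_insert (by decide), Finset.sum_insert (by decide),
    Finset.sum_singleton, ← one_add_two_I_pow_four_mul_add]
  rw [e2] at h1
  rw [e3] at h2
  rw [e5] at h3
  rw [e6] at h4
  rw [e1, e1'] at h
  linear_combination h - h0 - h1 - h2 - h3 - h4

end ZetaFormulas

/-! ### The constants $a_k,b_k,a'_k,b'_k$ and elimination of $C(i)$. -/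

section Constants

open Complex

theorem two_pow_sub_neg_one_pow_add_one_pos (k : ℕ) :
    (0 : ℝ) < 2 ^ (4 * k + 1) - (-1) ^ k * 2 ^ (2 * k) + 1 := by
  have h1 : (2 : ℝ) ^ (2 * k) ≤ 2 ^ (4 * k + 1) :=
    pow_le_pow_right₀ (by norm_num) (by omega)
  have h2 : (0 : ℝ) < 2 ^ (2 * k) := by positivity
  rcases neg_one_pow_eq_or ℝ k with h | h <;> rw [h] <;> linarith

theorem abs_five_pow_mul_cos_le (k : ℕ) :
    |5 ^ (2 * k) * Real.cos (4 * k * Real.arctan 2)| ≤ 5 ^ (2 * k) := by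
  rw [abs_mul, abs_of_pos (by positivity)]
  exact mul_le_of_le_one_right (by positivity) (Real.abs_cos_le_one _)

theorem five_pow_sub_cos_add_one_pos (k : ℕ) :
    (0 : ℝ) < 5 ^ (4 * k + 1) - 2 * 5 ^ (2 * k) * Real.cos (4 * k * Real.arctan 2) + 1 := by
  have h1 := (abs_le.mp (abs_five_pow_mul_cos_le k)).2
  have h2 : (5 : ℝ) ^ (2 * k) ≤ 5 ^ (4 * k) := pow_le_pow_right₀ (by norm_num) (by omega)
  have h3 : (0 : ℝ) < 5 ^ (4 * k) := by positivity
  rw [pow_succ]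
  linarith

/-- This is the numerator of $b_k$. It is positive because $2^{6k}=64^k\le81^k=3^{4k}$ and
$2^{4k}<3^{4k}$. -/
theorem three_pow_denominator_pos {k : ℕ} (hk : 0 < k) :
    (0 : ℝ) < 3 ^ (4 * k + 1) - 2 ^ (4 * k) - (-1) ^ k * 2 ^ (6 * k + 1) := by
  have h1 : (2 : ℝ) ^ (4 * k) < 3 ^ (4 * k) :=
    pow_lt_pow_left₀ (by norm_num) (by norm_num) (by omega)
  have h2 : (2 : ℝ) ^ (6 * k) ≤ 3 ^ (4 * k) := by
    rw [pow_mul, pow_mul]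
    exact pow_le_pow_left₀ (by norm_num) (by norm_num) k
  have h3 : (0 : ℝ) < 2 ^ (6 * k) := by positivity
  rw [pow_succ, pow_succ]
  rcases neg_one_pow_eq_or ℝ k with h | h <;> rw [h] <;> linarith

theorem three_pow_add_le_five_pow (k : ℕ) :
    (3 : ℝ) ^ (4 * k + 1) ≤
      5 ^ (4 * k + 1) - 2 * 5 ^ (2 * k) * Real.cos (4 * k * Real.arctan 2) := by
  have h1 := (abs_le.mp (abs_five_pow_mul_cos_le k)).2
  have h2 : (5 : ℝ) ^ (2 * k) ≤ 5 ^ (4 * k) := pow_le_pow_right₀ (by norm_num) (by omega)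
  have h3 : (3 : ℝ) ^ (4 * k) ≤ 5 ^ (4 * k) := pow_le_pow_left₀ (by norm_num) (by norm_num) _
  rw [pow_succ, pow_succ]
  linarith

theorem threeA_mul (k : ℕ) :
    threeA k * (2 ^ (4 * k + 1) - (-1) ^ k * 2 ^ (2 * k) + 1) =
      2 ^ (4 * k) * (3 ^ (4 * k + 1) + 1) :=
  div_mul_cancel₀ _ (by exact_mod_cast (two_pow_sub_neg_one_pow_add_one_pos k).ne')

theorem fiveA_mul (k : ℕ) :
    fiveA k * (2 ^ (4 * k) * (5 ^ (4 * k + 1) -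
      2 * 5 ^ (2 * k) * ((Real.cos (4 * k * Real.arctan 2) : ℝ) : ℂ) + 1)) =
      2 ^ (4 * k + 1) - (-1) ^ k * 2 ^ (2 * k) + 1 :=
  div_mul_cancel₀ _ (mul_ne_zero (by simp)
    (by exact_mod_cast (five_pow_sub_cos_add_one_pos k).ne'))

/-- In this form $2b_k$ is visibly the coefficient of $\zeta(4k+1)$ left when the $p=3$ relation is
subtracted from $a_k/2^{4k}$ times the $p=2$ relation. -/
theorem threeB_eq (k : ℕ) :
    threeB k = threeA k / 2 ^ (4 * k) - 1 - (-1) ^ k * 2 ^ (2 * k) := by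
  have h := threeA_mul k
  have h0 : (2 : ℂ) ^ (4 * k) ≠ 0 := by simp
  rw [threeB]
  rw [pow_succ 2] at h ⊢
  field_simp
  linear_combination -h

theorem gaussianPowerSum_two (k : ℕ) :
    gaussianPowerSum 2 (4 * k) = 1 + 2 * ((-1) ^ k * 2 ^ (2 * k)) +
      2 * 5 ^ (2 * k) * ((Real.cos (4 * k * Real.arctan 2) : ℝ) : ℂ) := by
  have e4 : Finset.Icc (-2 : ℤ) 2 = {0, 1, -1, 2, -2} := by decide
  rw [gaussianPowerSum, e4, Finset.sum_insert (by decide),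
    Finset.sum_insert (by decide), Finset.sum_insert (by decide), Finset.sum_insert (by decide),
    Finset.sum_singleton, ← one_add_two_I_pow_four_mul_add,
    show (4 * (k : ℤ)) = ((4 * k : ℕ) : ℤ) by push_cast; rfl]
  simp only [zpow_natCast, Int.cast_zero, Int.cast_one, Int.cast_neg, Int.cast_ofNat, mul_zero,
    add_zero, one_pow, mul_one, mul_neg, ← sub_eq_add_neg, one_add_I_pow_four_mul,
    one_sub_I_pow_four_mul, mul_comm I 2]
  ring

theorem fiveB_eq (k : ℕ) :
    fiveB k = 1 / 2 ^ (4 * k) - fiveA k * (1 + (-1) ^ k * 2 ^ (2 * k)) := by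
  have h := fiveA_mul k
  have h0 : (2 : ℂ) ^ (4 * k) ≠ 0 := by simp
  rw [fiveB, gaussianPowerSum_two]
  rw [pow_succ 2] at h ⊢
  field_simp
  linear_combination h

theorem threeB_eq_ofReal (k : ℕ) :
    threeB k = (((3 ^ (4 * k + 1) - 2 ^ (4 * k) - (-1) ^ k * 2 ^ (6 * k + 1)) /
      (2 ^ (4 * k + 1) - (-1) ^ k * 2 ^ (2 * k) + 1) : ℝ) : ℂ) := by
  have h := threeA_mul k
  have h0 : (2 : ℂ) ^ (4 * k) ≠ 0 := by simp
  have hY : (2 ^ (4 * k + 1) - (-1) ^ k * 2 ^ (2 * k) + 1 : ℂ) ≠ 0 := by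
    exact_mod_cast (two_pow_sub_neg_one_pow_add_one_pos k).ne'
  have h1 : threeA k / 2 ^ (4 * k) =
      (3 ^ (4 * k + 1) + 1) / (2 ^ (4 * k + 1) - (-1) ^ k * 2 ^ (2 * k) + 1) := by
    rw [div_eq_div_iff h0 hY, h]
    ring
  have hs : ((-1 : ℂ) ^ k) ^ 2 = 1 := by rw [← pow_mul, mul_comm, pow_mul]; simp
  push_cast
  rw [threeB_eq, h1, sub_sub, div_sub' hY, div_left_inj' hY,
    show 6 * k + 1 = 4 * k + 2 * k + 1 by omega]
  have e : (2 : ℂ) ^ (4 * k) = (2 ^ (2 * k)) ^ 2 := by rw [← pow_mul]; congr 1; omega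
  simp only [pow_succ (2 : ℂ) (4 * k), pow_succ (2 : ℂ) (4 * k + 2 * k),
    pow_add (2 : ℂ) (4 * k) (2 * k), e]
  linear_combination ((2 : ℂ) ^ (2 * k)) ^ 2 * hs

theorem fiveB_eq_fiveA_mul (k : ℕ) :
    fiveB k = fiveA k * (((5 ^ (4 * k + 1) - 2 * 5 ^ (2 * k) * Real.cos (4 * k * Real.arctan 2) -
      2 ^ (4 * k) - (-1) ^ k * 2 ^ (6 * k + 1)) /
      (2 ^ (4 * k + 1) - (-1) ^ k * 2 ^ (2 * k) + 1) : ℝ) : ℂ) := by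
  have h := fiveA_mul k
  have h0 : (2 : ℂ) ^ (4 * k) ≠ 0 := by simp
  have hY : (2 ^ (4 * k + 1) - (-1) ^ k * 2 ^ (2 * k) + 1 : ℂ) ≠ 0 := by
    exact_mod_cast (two_pow_sub_neg_one_pow_add_one_pos k).ne'
  have hs : ((-1 : ℂ) ^ k) ^ 2 = 1 := by rw [← pow_mul, mul_comm, pow_mul]; simp
  rw [ofReal_div, mul_div_assoc', eq_div_iff (by push_cast; exact hY), fiveB_eq, sub_mul,
    div_mul_eq_mul_div, sub_eq_iff_eq_add, div_eq_iff h0]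
  have e : (2 : ℂ) ^ (4 * k) = (2 ^ (2 * k)) ^ 2 := by rw [← pow_mul]; congr 1; omega
  push_cast at h ⊢
  rw [show 6 * k + 1 = 4 * k + 2 * k + 1 by omega]
  simp only [pow_succ (2 : ℂ) (4 * k), pow_succ (2 : ℂ) (4 * k + 2 * k),
    pow_add (2 : ℂ) (4 * k) (2 * k), e] at h ⊢
  linear_combination (-1 : ℂ) * h + fiveA k * ((2 : ℂ) ^ (2 * k)) ^ 4 * hs

theorem threeB_ne_zero {k : ℕ} (hk : 0 < k) : threeB k ≠ 0 := by
  rw [threeB_eq_ofReal]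
  exact ofReal_ne_zero.mpr
    (div_pos (three_pow_denominator_pos hk) (two_pow_sub_neg_one_pow_add_one_pos k)).ne'

theorem fiveA_ne_zero (k : ℕ) : fiveA k ≠ 0 := by
  intro h
  have h1 := fiveA_mul k
  rw [h, zero_mul] at h1
  exact (two_pow_sub_neg_one_pow_add_one_pos k).ne (by exact_mod_cast h1)

theorem fiveB_ne_zero {k : ℕ} (hk : 0 < k) : fiveB k ≠ 0 := by
  rw [fiveB_eq_fiveA_mul]
  refine mul_ne_zero (fiveA_ne_zero k) (ofReal_ne_zero.mpr
    (div_pos ?_ (two_pow_sub_neg_one_pow_add_one_pos k)).ne')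
  linarith [three_pow_denominator_pos hk, three_pow_add_le_five_pow k]

/-- Splitting off $-2F(e^{-4\pi})$, which also occurs in the $p=5$ formula, leaves a combination
whose coefficients no longer involve $a_k$; this prepares the comparison of the two Lambert parts.
-/
theorem threeLambert_eq {k : ℕ} (hk : 0 < k) (F : ℂ → ℂ) :
    threeLambert k F = -(2 / threeB k) * ((1 + (-1) ^ k * 2 ^ (2 * k)) * F (expPi 4) -
      (-1) ^ k * 2 ^ (2 * k) * F (-expPi 3) - F (expPi 6)) - 2 * F (expPi 4) := by
  have hB := threeB_ne_zero hk
  have h0 : (2 : ℂ) ^ (4 * k) ≠ 0 := by simp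
  have h1 : threeA k = 2 ^ (4 * k) * (threeB k + 1 + (-1) ^ k * 2 ^ (2 * k)) := by
    rw [threeB_eq]
    field_simp
    ring
  have e1 : (2 : ℂ) ^ (4 * k) = 2 * 2 ^ (4 * k - 1) := by rw [← pow_succ']; congr 1; omega
  have e2 : (2 : ℂ) ^ (2 * k) = 2 * 2 ^ (2 * k - 1) := by rw [← pow_succ']; congr 1; omega
  rw [threeLambert, h1, e1, pow_succ 2 (2 * k), e2]
  field_simp
  ring

theorem fiveLambert_eq {k : ℕ} (hk : 0 < k) (F : ℂ → ℂ) :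
    fiveLambert k F = -(2 * fiveA k / fiveB k) * ((1 + (-1) ^ k * 2 ^ (2 * k)) * F (expPi 4) -
      (-1) ^ k * 2 ^ (2 * k) * F (-expPi 5) - F (expPi 10)) - 2 * F (expPi 4) := by
  have hB := fiveB_ne_zero hk
  have h0 : (2 : ℂ) ^ (4 * k) ≠ 0 := by simp
  have h1 : 1 / (2 ^ (4 * k - 1) * fiveB k) =
      2 * (fiveB k + fiveA k * (1 + (-1) ^ k * 2 ^ (2 * k))) / fiveB k := by
    have e1 : (2 : ℂ) ^ (4 * k) = 2 * 2 ^ (4 * k - 1) := by rw [← pow_succ']; congr 1; omega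
    nth_rewrite 2 [fiveB_eq]
    rw [e1]
    field_simp
    ring
  rw [fiveLambert, h1, pow_succ 2 (2 * k)]
  field_simp
  ring

theorem riemannZeta_eq_threePi {k : ℕ} (hk : 0 < k) :
    riemannZeta (4 * (k : ℂ) + 1) = threePi k * (Real.pi : ℂ) ^ (4 * k + 1) +
      threeLambert k (fun q => lambertL q (-4 * (k : ℂ) - 1)) := by
  have hB := threeB_ne_zero hk
  have h0 : (2 : ℂ) ^ (4 * k) ≠ 0 := by simp
  have h2 := cotSum_hecke_two hk
  have h3 := cotSum_hecke_three hk
  have w2 := cotSum_natCast_mul_I hk (m := 2) (by norm_num)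
  have w3 := cotSum_natCast_mul_I hk (m := 3) (by norm_num)
  have wh := cotSum_half hk (m := 3) (by norm_num)
  norm_num only [Nat.cast_ofNat] at w2 w3 wh
  rw [w2] at h2
  rw [w3, wh] at h3
  have hA : threeA k / 2 ^ (4 * k) = threeB k + 1 + (-1) ^ k * 2 ^ (2 * k) := by
    rw [threeB_eq]
    ring
  have hY : (threeA k / 2 ^ (4 * k)) * (2 ^ (4 * k + 1) - (-1) ^ k * 2 ^ (2 * k) + 1) =
      3 ^ (4 * k + 1) + 1 := by
    rw [div_mul_eq_mul_div, threeA_mul, mul_div_cancel_left₀ _ h0]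
  have hC : bernoulliSum k (threeC k) = bernoulliSum k (oddBracket 3 1 k) -
      (threeA k / 2 ^ (4 * k)) * (2 ^ (4 * k) * bernoulliSum k (twoBracket k)) := by
    rw [← mul_assoc, div_mul_cancel₀ _ h0, ← bernoulliSum_mul_left, ← bernoulliSum_sub]
    rfl
  rw [threeLambert_eq hk, threePi, hC]
  rw [hA] at hY ⊢
  rw [mul_pow] at h2 h3
  generalize -4 * (k : ℂ) - 1 = s at h2 h3 ⊢
  field_simp
  -- The multiplier of `h2` is $a_k/2^{4k}$, the ratio of the coefficients of $C(i)$, so $C(i)$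
  -- cancels by `hY`.
  linear_combination (-1 : ℂ) * h3 + (threeB k + 1 + (-1) ^ k * 2 ^ (2 * k)) * h2
    + cotSum (4 * k + 1) I * hY

theorem riemannZeta_eq_fivePi {k : ℕ} (hk : 0 < k) :
    riemannZeta (4 * (k : ℂ) + 1) = fivePi k * (Real.pi : ℂ) ^ (4 * k + 1) +
      fiveLambert k (fun q => lambertL q (-4 * (k : ℂ) - 1)) := by
  have hB := fiveB_ne_zero hk
  have h0 : (2 : ℂ) ^ (4 * k) ≠ 0 := by simp
  have h2 := cotSum_hecke_two hk
  have h5 := cotSum_hecke_five hk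
  have w2 := cotSum_natCast_mul_I hk (m := 2) (by norm_num)
  have w5 := cotSum_natCast_mul_I hk (m := 5) (by norm_num)
  have wh := cotSum_half hk (m := 5) (by norm_num)
  norm_num only [Nat.cast_ofNat] at w2 w5 wh
  rw [w2] at h2
  rw [w5, wh] at h5
  have hA : 1 / 2 ^ (4 * k) = fiveB k + fiveA k * (1 + (-1) ^ k * 2 ^ (2 * k)) := by
    rw [fiveB_eq]
    ring
  have hY := fiveA_mul k
  have hC : bernoulliSum k (fiveC k) = fiveA k * bernoulliSum k (oddBracket 5 2 k) -
      (1 / 2 ^ (4 * k)) * (2 ^ (4 * k) * bernoulliSum k (twoBracket k)) := by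
    rw [← mul_assoc, div_mul_cancel₀ _ h0, one_mul, ← bernoulliSum_mul_left, ← bernoulliSum_sub]
    rfl
  have hY' : fiveA k * (5 ^ (4 * k + 1) -
      2 * 5 ^ (2 * k) * ((Real.cos (4 * k * Real.arctan 2) : ℝ) : ℂ) + 1) =
      (1 / 2 ^ (4 * k)) * (2 ^ (4 * k + 1) - (-1) ^ k * 2 ^ (2 * k) + 1) := by
    rw [← hY]
    field_simp
  rw [fiveLambert_eq hk, fivePi, hC]
  rw [hA] at hY' ⊢
  rw [mul_pow] at h2 h5
  generalize -4 * (k : ℂ) - 1 = s at h2 h5 ⊢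
  field_simp
  linear_combination -fiveA k * h5 + (fiveB k + fiveA k * (1 + (-1) ^ k * 2 ^ (2 * k))) * h2
    - cotSum (4 * k + 1) I * hY'

end Constants

/-! ### Tails of Lambert series, $P_k\ne P'_k$, and rates of convergence. -/

section Estimates

open Complex Filter Asymptotics

theorem norm_lambertTerm_neg_natCast_le {q : ℂ} (hq : ‖q‖ < 1) (s : ℕ) {n : ℕ} (hn : 0 < n) :
    ‖lambertTerm q (-(s : ℂ)) n‖ ≤ ‖q‖ ^ n / (1 - ‖q‖) := by
  have hpos : 0 < 1 - ‖q‖ := by linarith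
  have hpow : ‖q‖ ^ n ≤ ‖q‖ := pow_le_of_le_one (norm_nonneg q) hq.le hn.ne'
  have hden : 1 - ‖q‖ ≤ ‖1 - q ^ n‖ := by
    have h := norm_sub_norm_le (1 : ℂ) (q ^ n)
    rw [norm_one, norm_pow] at h
    linarith
  have hn1 : (1 : ℝ) ≤ (n : ℝ) ^ s := one_le_pow₀ (by exact_mod_cast hn)
  rw [lambertTerm_neg_natCast, norm_div, norm_div, norm_pow, norm_pow, norm_natCast]
  refine (div_le_self (by positivity) hn1).trans ?_
  gcongr

theorem lambertPartial_eq_sum_range (q s : ℂ) (N : ℕ) :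
    lambertPartial q s N = ∑ n ∈ Finset.range N, lambertTerm q s (n + 1) := by
  rw [lambertPartial, Finset.range_eq_Ico, Finset.sum_Ico_add' (lambertTerm q s) 0 N 1]
  rfl

theorem lambertL_sub_lambertPartial {q : ℂ} (hq : ‖q‖ < 1) (s : ℂ) (N : ℕ) :
    lambertL q s - lambertPartial q s N = ∑' n : ℕ, lambertTerm q s (n + N + 1) := by
  rw [lambertPartial_eq_sum_range, lambertL, sub_eq_iff_eq_add',
    (summable_lambertTerm hq s).sum_add_tsum_nat_add]

/-- One factor $1-|q|$ bounds the denominators $1-q^n$, the other comes from summing the geometric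
series. -/
theorem norm_lambertL_sub_lambertPartial_le {q : ℂ} (hq : ‖q‖ < 1) (s N : ℕ) :
    ‖lambertL q (-(s : ℂ)) - lambertPartial q (-(s : ℂ)) N‖ ≤ ‖q‖ ^ (N + 1) / (1 - ‖q‖) ^ 2 := by
  have hpos : 0 < 1 - ‖q‖ := by linarith
  rw [lambertL_sub_lambertPartial hq]
  have h := (hasSum_geometric_of_lt_one (norm_nonneg q) hq).mul_left (‖q‖ ^ (N + 1) / (1 - ‖q‖))
  have e : ‖q‖ ^ (N + 1) / (1 - ‖q‖) * (1 - ‖q‖)⁻¹ = ‖q‖ ^ (N + 1) / (1 - ‖q‖) ^ 2 := by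
    field_simp
  rw [e] at h
  refine tsum_of_norm_bounded h fun n => ?_
  refine (norm_lambertTerm_neg_natCast_le hq s (by omega)).trans (le_of_eq ?_)
  rw [show n + N + 1 = (N + 1) + n by ring, pow_add]
  ring

theorem isBigO_lambertL_sub_lambertPartial {q : ℂ} {r : ℝ} (hq : ‖q‖ < 1) (hr : ‖q‖ ≤ r) (s : ℕ) :
    (fun N : ℕ => lambertL q (-(s : ℂ)) - lambertPartial q (-(s : ℂ)) N)
      =O[atTop] fun N : ℕ => r ^ N := by
  have hpos : 0 < 1 - ‖q‖ := by linarith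
  refine IsBigO.of_bound (‖q‖ / (1 - ‖q‖) ^ 2) (Eventually.of_forall fun N => ?_)
  refine (norm_lambertL_sub_lambertPartial_le hq s N).trans ?_
  rw [norm_pow, Real.norm_eq_abs, pow_succ', mul_div_right_comm]
  gcongr
  exact hr.trans (le_abs_self r)

/-- For a positive nome all terms are positive, so the tail is at least its first term. -/
theorem le_norm_lambertL_sub_lambertPartial {x : ℝ} (hx0 : 0 < x) (hx1 : x < 1) (s N : ℕ) :
    x ^ (N + 1) / ((N + 1 : ℕ) : ℝ) ^ s ≤
      ‖lambertL (x : ℂ) (-(s : ℂ)) - lambertPartial (x : ℂ) (-(s : ℂ)) N‖ := by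
  have hq : ‖(x : ℂ)‖ < 1 := by rwa [norm_real, Real.norm_of_nonneg hx0.le]
  set f : ℕ → ℝ := fun n => x ^ n / (1 - x ^ n) / (n : ℝ) ^ s with hf
  have hterm : ∀ n : ℕ, lambertTerm (x : ℂ) (-(s : ℂ)) n = (f n : ℂ) := by
    intro n
    rw [lambertTerm_neg_natCast, hf]
    push_cast
    rfl
  have hnn : ∀ n : ℕ, 0 < 1 - x ^ (n + 1) := fun n =>
    sub_pos.mpr (pow_lt_one₀ hx0.le hx1 n.succ_ne_zero)
  have hs := (summable_nat_add_iff N).mpr (summable_lambertTerm hq (-(s : ℂ)))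
  rw [lambertL_sub_lambertPartial hq]
  simp only [hterm] at hs ⊢
  rw [← ofReal_tsum, norm_real]
  have hs' : Summable fun n : ℕ => f (n + N + 1) := by exact_mod_cast hs
  have h0 : ∀ n : ℕ, 0 ≤ f (n + N + 1) := fun n => by
    have := hnn (n + N)
    simp only [hf]
    positivity
  refine le_trans ?_ (le_abs_self _)
  refine le_trans ?_ (hs'.le_tsum 0 fun n _ => h0 n)
  simp only [hf, zero_add]
  gcongr
  rw [le_div_iff₀ (hnn N)]
  have : 0 < x ^ (N + 1) := by positivity
  nlinarith

theorem isLittleO_sq_pow_lambertL_sub_lambertPartial {x : ℝ} (hx0 : 0 < x) (hx1 : x < 1) (s : ℕ) :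
    (fun N : ℕ => (x ^ 2) ^ N) =o[atTop]
      fun N : ℕ => lambertL (x : ℂ) (-(s : ℂ)) - lambertPartial (x : ℂ) (-(s : ℂ)) N := by
  have h1 : (fun N : ℕ => x ^ (N + 1) / ((N + 1 : ℕ) : ℝ) ^ s) =O[atTop]
      fun N : ℕ => lambertL (x : ℂ) (-(s : ℂ)) - lambertPartial (x : ℂ) (-(s : ℂ)) N := by
    refine IsBigO.of_bound 1 (Eventually.of_forall fun N => ?_)
    rw [Real.norm_of_nonneg (by positivity), one_mul]
    exact le_norm_lambertL_sub_lambertPartial hx0 hx1 s N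
  refine IsLittleO.trans_isBigO ?_ h1
  refine isLittleO_iff_exists_eq_mul.mpr
    ⟨fun N : ℕ => (x ^ 2)⁻¹ * (((N + 1 : ℕ) : ℝ) ^ s * x ^ (N + 1)), ?_, ?_⟩
  · have h2 := tendsto_pow_const_mul_const_pow_of_abs_lt_one s
      (show |x| < 1 by rwa [abs_of_pos hx0])
    simpa using ((tendsto_add_atTop_iff_nat 1).mpr h2).const_mul (x ^ 2)⁻¹
  · refine Eventually.of_forall fun N => ?_
    have hN : ((N + 1 : ℕ) : ℝ) ≠ 0 := by positivity
    simp only [Pi.mul_apply]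
    field_simp
    ring

theorem norm_expPi (m : ℝ) : ‖expPi m‖ = Real.exp (-(m * Real.pi)) := by
  rw [expPi, norm_real, Real.norm_of_nonneg (Real.exp_nonneg _)]

theorem exp_neg_mul_pi_le_exp_neg_mul_pi {a b : ℝ} (h : a ≤ b) :
    Real.exp (-(b * Real.pi)) ≤ Real.exp (-(a * Real.pi)) :=
  Real.exp_le_exp.mpr (neg_le_neg (mul_le_mul_of_nonneg_right h Real.pi_pos.le))

theorem exp_neg_pi_lt : Real.exp (-Real.pi) < 1 / 20 := by
  have h1 : Real.exp (-Real.pi) < Real.exp (-3) := Real.exp_lt_exp.mpr (by linarith [Real.pi_gt_three])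
  have h2 : (20 : ℝ) < Real.exp 3 := by
    rw [show (3 : ℝ) = ((3 : ℕ) : ℝ) * 1 by norm_num, Real.exp_nat_mul]
    calc (20 : ℝ) < 2.718 ^ 3 := by norm_num
      _ ≤ Real.exp 1 ^ 3 := by
        gcongr
        linarith [Real.exp_one_gt_d9]
  rw [Real.exp_neg 3] at h1
  refine h1.trans_le ?_
  rw [one_div]
  exact inv_anti₀ (by norm_num) h2.le

theorem norm_expPi_lt_one {m : ℝ} (hm : 0 < m) : ‖expPi m‖ < 1 := by
  rw [norm_expPi, Real.exp_lt_one_iff]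
  have := Real.pi_pos
  simp only [Left.neg_neg_iff]
  positivity

theorem norm_lambertL_le {q : ℂ} (hq : ‖q‖ ≤ 1 / 20) (s : ℕ) :
    ‖lambertL q (-(s : ℂ))‖ ≤ 6 / 5 * ‖q‖ := by
  have h := norm_lambertL_sub_lambertPartial_le (by linarith : ‖q‖ < 1) s 0
  rw [show lambertPartial q (-(s : ℂ)) 0 = 0 by simp [lambertPartial], sub_zero] at h
  have h0 := norm_nonneg q
  have h1 : 1 ≤ 6 / 5 * (1 - ‖q‖) ^ 2 := by nlinarith
  refine h.trans ?_
  rw [div_le_iff₀ (by nlinarith), zero_add, pow_one]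
  nlinarith [mul_le_mul_of_nonneg_left h1 h0]

/-- The first term $q/(1-q)$ has modulus at least $\frac9{10}|q|$ and the remaining terms total at
most $\frac1{10}|q|$. -/
theorem le_norm_lambertL {q : ℂ} (hq : ‖q‖ ≤ 1 / 20) (s : ℕ) :
    4 / 5 * ‖q‖ ≤ ‖lambertL q (-(s : ℂ))‖ := by
  have h := norm_lambertL_sub_lambertPartial_le (by linarith : ‖q‖ < 1) s 1
  have h0 := norm_nonneg q
  have h1 : ‖q‖ ^ (1 + 1) / (1 - ‖q‖) ^ 2 ≤ 1 / 10 * ‖q‖ := by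
    rw [div_le_iff₀ (by nlinarith)]
    nlinarith [mul_nonneg h0 h0, mul_nonneg h0 (mul_nonneg h0 h0)]
  have h2 : 9 / 10 * ‖q‖ ≤ ‖lambertPartial q (-(s : ℂ)) 1‖ := by
    rw [lambertPartial_eq_sum_range, Finset.sum_range_one, lambertTerm_neg_natCast]
    simp only [zero_add, pow_one, Nat.cast_one, one_pow, div_one, norm_div]
    have h3 : ‖1 - q‖ ≤ 1 + ‖q‖ := by simpa using norm_sub_le (1 : ℂ) q
    have h4 : 0 < ‖1 - q‖ := by
      have := norm_sub_norm_le (1 : ℂ) q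
      rw [norm_one] at this
      linarith
    rw [le_div_iff₀ h4]
    nlinarith
  have h5 := norm_sub_norm_le (lambertPartial q (-(s : ℂ)) 1) (lambertL q (-(s : ℂ)))
  rw [norm_sub_rev] at h5
  linarith

theorem neg_four_mul_sub_one (k : ℕ) : -4 * (k : ℂ) - 1 = -((4 * k + 1 : ℕ) : ℂ) := by
  push_cast
  ring

theorem norm_neg_one_pow_mul (k : ℕ) (z : ℂ) :
    ‖(-1) ^ k * 2 ^ (2 * k) * z‖ = 2 ^ (2 * k) * ‖z‖ := by
  simp

theorem four_le_two_pow {k : ℕ} (hk : 0 < k) : (4 : ℝ) ≤ 2 ^ (2 * k) := by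
  rw [pow_mul]
  norm_num
  exact le_self_pow₀ (by norm_num) hk.ne'

/-- With $x=e^{-\pi}<1/20$, the term $4^k\mathcal L(-e^{-3\pi})$ has size about $4^kx^3$; every
other term is smaller by at least about a factor $x$, and $4^k\ge4$ absorbs those without the factor
$4^k$. -/
theorem norm_five_combination_lt_norm_three_combination {k : ℕ} (hk : 0 < k) (s : ℕ) :
    ‖(1 + (-1) ^ k * 2 ^ (2 * k)) * lambertL (expPi 4) (-(s : ℂ)) -
        (-1) ^ k * 2 ^ (2 * k) * lambertL (-expPi 5) (-(s : ℂ)) - lambertL (expPi 10) (-(s : ℂ))‖ <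
      ‖(1 + (-1) ^ k * 2 ^ (2 * k)) * lambertL (expPi 4) (-(s : ℂ)) -
        (-1) ^ k * 2 ^ (2 * k) * lambertL (-expPi 3) (-(s : ℂ)) -
          lambertL (expPi 6) (-(s : ℂ))‖ := by
  have ht := four_le_two_pow hk
  set x := Real.exp (-Real.pi) with hx
  have hx0 : 0 < x := Real.exp_pos _
  have hx1 : x < 1 / 20 := exp_neg_pi_lt
  have hm : ∀ m : ℕ, Real.exp (-((m : ℝ) * Real.pi)) = x ^ m := by
    intro m
    rw [hx, ← Real.exp_nat_mul]
    congr 1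
    ring
  have n3 : ‖-expPi 3‖ = x ^ 3 := by rw [norm_neg, norm_expPi]; exact_mod_cast hm 3
  have n4 : ‖expPi 4‖ = x ^ 4 := by rw [norm_expPi]; exact_mod_cast hm 4
  have n5 : ‖-expPi 5‖ = x ^ 5 := by rw [norm_neg, norm_expPi]; exact_mod_cast hm 5
  have n6 : ‖expPi 6‖ = x ^ 6 := by rw [norm_expPi]; exact_mod_cast hm 6
  have n10 : ‖expPi 10‖ = x ^ 10 := by rw [norm_expPi]; exact_mod_cast hm 10
  have hy0 : 0 < x ^ 3 := by positivity
  have hle : ∀ m : ℕ, x ^ (m + 3) ≤ (1 / 20) ^ m * x ^ 3 := fun m => by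
    rw [pow_add]
    gcongr
  have hy3 : x ^ 3 ≤ 1 / 20 := by nlinarith [pow_le_one₀ hx0.le (by linarith : x ≤ 1) (n := 2)]
  have y4 := hle 1
  have y5 := hle 2
  have y6 := hle 3
  have y10 := hle 7
  norm_num only at y4 y5 y6 y10
  have b3 := le_norm_lambertL (n3 ▸ hy3) s
  have b4 := norm_lambertL_le (q := expPi 4) (by rw [n4]; linarith) s
  have b5 := norm_lambertL_le (q := -expPi 5) (by rw [n5]; linarith) s
  have b6 := norm_lambertL_le (q := expPi 6) (by rw [n6]; linarith) s
  have b10 := norm_lambertL_le (q := expPi 10) (by rw [n10]; linarith) s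
  rw [n3] at b3
  rw [n4] at b4
  rw [n5] at b5
  rw [n6] at b6
  rw [n10] at b10
  generalize lambertL (-expPi 3) (-(s : ℂ)) = F3 at *
  generalize lambertL (expPi 4) (-(s : ℂ)) = F4 at *
  generalize lambertL (-expPi 5) (-(s : ℂ)) = F5 at *
  generalize lambertL (expPi 6) (-(s : ℂ)) = F6 at *
  generalize lambertL (expPi 10) (-(s : ℂ)) = F10 at *
  have c4 : ‖(1 + (-1) ^ k * 2 ^ (2 * k)) * F4‖ ≤ (1 + 2 ^ (2 * k)) * ‖F4‖ := by
    rw [norm_mul]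
    gcongr
    refine (norm_add_le _ _).trans (le_of_eq ?_)
    simp
  have c5 := norm_neg_one_pow_mul k F5
  have c3 := norm_neg_one_pow_mul k F3
  generalize (1 + (-1) ^ k * 2 ^ (2 * k)) * F4 = A at *
  generalize (-1) ^ k * 2 ^ (2 * k) * F5 = B at *
  generalize (-1) ^ k * 2 ^ (2 * k) * F3 = C at *
  generalize (2 : ℝ) ^ (2 * k) = t at *
  have hup : ‖A - B - F10‖ ≤ ‖A‖ + ‖B‖ + ‖F10‖ :=
    (norm_sub_le _ _).trans (add_le_add_left (norm_sub_le _ _) _)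
  have hlow : ‖C‖ - ‖A‖ - ‖F6‖ ≤ ‖A - C - F6‖ := by
    have h1 := norm_sub_norm_le C (A - F6)
    have h2 := norm_sub_le A F6
    rw [show A - C - F6 = -(C - (A - F6)) by ring, norm_neg]
    linarith
  have d4 : ‖A‖ ≤ (1 + t) * (3 / 50 * x ^ 3) :=
    c4.trans (mul_le_mul_of_nonneg_left (by linarith) (by linarith))
  have d5 : ‖B‖ ≤ t * (3 / 1000 * x ^ 3) := by
    rw [c5]
    exact mul_le_mul_of_nonneg_left (by linarith) (by linarith)
  have d3 : t * (4 / 5 * x ^ 3) ≤ ‖C‖ := by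
    rw [c3]
    exact mul_le_mul_of_nonneg_left (by linarith) (by linarith)
  have d1 : 4 * x ^ 3 ≤ t * x ^ 3 := mul_le_mul_of_nonneg_right ht hy0.le
  refine hup.trans_lt (lt_of_lt_of_le ?_ hlow)
  linarith

theorem threePi_ne_fivePi {k : ℕ} (hk : 0 < k) : threePi k ≠ fivePi k := by
  intro h
  have h3 := riemannZeta_eq_threePi hk
  have h5 := riemannZeta_eq_fivePi hk
  rw [h] at h3
  have hT := add_left_cancel (h3.symm.trans h5)
  rw [threeLambert_eq hk, fiveLambert_eq hk, neg_four_mul_sub_one] at hT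
  have hlt := norm_five_combination_lt_norm_three_combination hk (4 * k + 1)
  have hY := two_pow_sub_neg_one_pow_add_one_pos k
  have hM := three_pow_denominator_pos hk
  have hMM := three_pow_add_le_five_pow k
  have hA := fiveA_ne_zero k
  rw [fiveB_eq_fiveA_mul, threeB_eq_ofReal] at hT
  set Y : ℝ := 2 ^ (4 * k + 1) - (-1) ^ k * 2 ^ (2 * k) + 1
  set M : ℝ := 3 ^ (4 * k + 1) - 2 ^ (4 * k) - (-1) ^ k * 2 ^ (6 * k + 1) with hMdef
  set M' : ℝ := 5 ^ (4 * k + 1) - 2 * 5 ^ (2 * k) * Real.cos (4 * k * Real.arctan 2) -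
    2 ^ (4 * k) - (-1) ^ k * 2 ^ (6 * k + 1) with hMdef'
  have hle : M ≤ M' := by linarith
  have hM' : 0 < M' := hM.trans_le hle
  generalize (1 + (-1) ^ k * 2 ^ (2 * k)) * lambertL (expPi 4) (-((4 * k + 1 : ℕ) : ℂ)) -
        (-1) ^ k * 2 ^ (2 * k) * lambertL (-expPi 5) (-((4 * k + 1 : ℕ) : ℂ)) -
        lambertL (expPi 10) (-((4 * k + 1 : ℕ) : ℂ)) = G5 at *
  generalize (1 + (-1) ^ k * 2 ^ (2 * k)) * lambertL (expPi 4) (-((4 * k + 1 : ℕ) : ℂ)) -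
        (-1) ^ k * 2 ^ (2 * k) * lambertL (-expPi 3) (-((4 * k + 1 : ℕ) : ℂ)) -
        lambertL (expPi 6) (-((4 * k + 1 : ℕ) : ℂ)) = G3 at *
  have hYc : (Y : ℂ) ≠ 0 := ofReal_ne_zero.mpr hY.ne'
  have hMc : (M : ℂ) ≠ 0 := ofReal_ne_zero.mpr hM.ne'
  have hMc' : (M' : ℂ) ≠ 0 := ofReal_ne_zero.mpr hM'.ne'
  -- As $b_k=M/Y$ and $b'_k/a'_k=M'/Y$, equality of the Lambert parts means $G_3/M=G_5/M'$.
  have hG : (M' : ℂ) * G3 = M * G5 := by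
    have h1 := sub_left_inj.mp hT
    rw [ofReal_div, ofReal_div] at h1
    field_simp at h1
    linear_combination -h1
  have hn := congrArg norm hG
  rw [norm_mul, norm_mul, norm_real, norm_real, Real.norm_of_nonneg hM.le,
    Real.norm_of_nonneg hM'.le] at hn
  have h6 : M * ‖G5‖ < M * ‖G3‖ := mul_lt_mul_of_pos_left hlt hM
  have h7 : M * ‖G3‖ ≤ M' * ‖G3‖ := mul_le_mul_of_nonneg_right hle (norm_nonneg _)
  linarith

theorem pi_pow_eq_combinedLambert {k : ℕ} (hk : 0 < k) :
    (Real.pi : ℂ) ^ (4 * k + 1) =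
      combinedLambert k (fun q => lambertL q (-4 * (k : ℂ) - 1)) := by
  have h := sub_ne_zero.mpr (threePi_ne_fivePi hk)
  rw [combinedLambert, eq_div_iff h]
  linear_combination riemannZeta_eq_fivePi hk - riemannZeta_eq_threePi hk

theorem combinedLambert_sub (k : ℕ) (F G : ℂ → ℂ) :
    combinedLambert k F - combinedLambert k G = combinedLambert k (fun q => F q - G q) := by
  simp only [combinedLambert, threeLambert, fiveLambert]
  ring

theorem isBigO_combinedLambert {α : Type*} {l : Filter α} {g : α → ℝ} (k : ℕ) {F : α → ℂ → ℂ}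
    (h3 : (fun a => F a (-expPi 3)) =O[l] g) (h4 : (fun a => F a (expPi 4)) =O[l] g)
    (h5 : (fun a => F a (-expPi 5)) =O[l] g) (h6 : (fun a => F a (expPi 6)) =O[l] g)
    (h10 : (fun a => F a (expPi 10)) =O[l] g) :
    (fun a => combinedLambert k (F a)) =O[l] g := by
  simp only [combinedLambert, threeLambert, fiveLambert, div_eq_mul_inv _ (threePi k - fivePi k),
    mul_comm _ (threePi k - fivePi k)⁻¹]
  exact IsBigO.const_mul_left ((((h4.const_mul_left _).add (h5.const_mul_left _)).add
    (h10.const_mul_left _)).sub (((h3.const_mul_left _).sub (h4.const_mul_left _)).add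
    (h6.const_mul_left _))) _

theorem isBigO_pi_pow_sub_combinedLambert {k : ℕ} (hk : 0 < k) :
    (fun N : ℕ => (Real.pi : ℂ) ^ (4 * k + 1) -
        combinedLambert k (fun q => lambertPartial q (-4 * (k : ℂ) - 1) N))
      =O[atTop] (fun N : ℕ => Real.exp (-(3 * Real.pi * N))) := by
  simp only [pi_pow_eq_combinedLambert hk, combinedLambert_sub, neg_four_mul_sub_one]
  have hr : (fun N : ℕ => Real.exp (-(3 * Real.pi * N))) =
      fun N : ℕ => Real.exp (-(3 * Real.pi)) ^ N := by
    funext N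
    rw [← Real.exp_nat_mul]
    congr 1
    ring
  rw [hr]
  have key : ∀ m : ℝ, 3 ≤ m → ‖expPi m‖ < 1 ∧ ‖expPi m‖ ≤ Real.exp (-(3 * Real.pi)) := fun m hm =>
    ⟨norm_expPi_lt_one (by linarith), by
      rw [norm_expPi]; exact exp_neg_mul_pi_le_exp_neg_mul_pi hm⟩
  have hpos : ∀ m : ℝ, 3 ≤ m → (fun N : ℕ => lambertL (expPi m) (-((4 * k + 1 : ℕ) : ℂ)) -
      lambertPartial (expPi m) (-((4 * k + 1 : ℕ) : ℂ)) N) =O[atTop]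
      fun N : ℕ => Real.exp (-(3 * Real.pi)) ^ N := fun m hm =>
    isBigO_lambertL_sub_lambertPartial (key m hm).1 (key m hm).2 (4 * k + 1)
  have hneg : ∀ m : ℝ, 3 ≤ m → (fun N : ℕ => lambertL (-expPi m) (-((4 * k + 1 : ℕ) : ℂ)) -
      lambertPartial (-expPi m) (-((4 * k + 1 : ℕ) : ℂ)) N) =O[atTop]
      fun N : ℕ => Real.exp (-(3 * Real.pi)) ^ N := fun m hm =>
    isBigO_lambertL_sub_lambertPartial (q := -expPi m) (by rw [norm_neg]; exact (key m hm).1)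
      (by rw [norm_neg]; exact (key m hm).2) (4 * k + 1)
  exact isBigO_combinedLambert k (hneg 3 le_rfl) (hpos 4 (by norm_num)) (hneg 5 (by norm_num))
    (hpos 6 (by norm_num)) (hpos 10 (by norm_num))

/-- The tails at $q_2,q_3$ are $O(x^{2N})$, hence negligible against the tail at $x$; they cannot
cancel it whatever $v,w$ are. -/
theorem isLittleO_sq_pow_combination {x : ℝ} (hx0 : 0 < x) (hx1 : x < 1) (s : ℕ) {q₂ q₃ : ℂ}
    (h₂ : ‖q₂‖ ≤ x ^ 2) (h₃ : ‖q₃‖ ≤ x ^ 2) {u : ℂ} (hu : u ≠ 0) (v w : ℂ) :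
    (fun N : ℕ => (x ^ 2) ^ N) =o[atTop] fun N : ℕ =>
      (u * lambertL x (-(s : ℂ)) + v * lambertL q₂ (-(s : ℂ)) + w * lambertL q₃ (-(s : ℂ))) -
      (u * lambertPartial x (-(s : ℂ)) N + v * lambertPartial q₂ (-(s : ℂ)) N +
        w * lambertPartial q₃ (-(s : ℂ)) N) := by
  have hx2 : x ^ 2 < 1 := pow_lt_one₀ hx0.le hx1 two_ne_zero
  have h0 := (isLittleO_sq_pow_lambertL_sub_lambertPartial hx0 hx1 s).trans_isBigO
    (isBigO_self_const_mul hu _ atTop)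
  have hrest := (((isBigO_lambertL_sub_lambertPartial (h₂.trans_lt hx2) h₂ s).const_mul_left v).add
    ((isBigO_lambertL_sub_lambertPartial (h₃.trans_lt hx2) h₃ s).const_mul_left w)).trans_isLittleO
    h0
  refine (h0.trans_isBigO hrest.right_isBigO_add).congr_right fun N => ?_
  ring

theorem isLittleO_pi_pow_sub_combinedLambert {k : ℕ} (hk : 0 < k) {u : ℂ} (hu : u ≠ 0) (v w : ℂ) :
    (fun N : ℕ => (Real.pi : ℂ) ^ (4 * k + 1) -
        combinedLambert k (fun q => lambertPartial q (-4 * (k : ℂ) - 1) N))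
      =o[atTop] fun N : ℕ =>
        (u * lambertL (expPi 1) (-4 * (k : ℂ) - 1) + v * lambertL (expPi 2) (-4 * (k : ℂ) - 1) +
          w * lambertL (expPi 4) (-4 * (k : ℂ) - 1)) -
        (u * lambertPartial (expPi 1) (-4 * (k : ℂ) - 1) N +
          v * lambertPartial (expPi 2) (-4 * (k : ℂ) - 1) N +
          w * lambertPartial (expPi 4) (-4 * (k : ℂ) - 1) N) := by
  have hx0 := Real.exp_pos (-(1 * Real.pi))
  have hx1 : Real.exp (-(1 * Real.pi)) < 1 := by
    rw [Real.exp_lt_one_iff]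
    linarith [Real.pi_pos]
  have hx2 : Real.exp (-(1 * Real.pi)) ^ 2 = Real.exp (-(2 * Real.pi)) := by
    rw [← Real.exp_nat_mul]
    congr 1
    push_cast
    ring
  have h := isLittleO_sq_pow_combination hx0 hx1 (4 * k + 1) (q₂ := expPi 2) (q₃ := expPi 4)
    (by rw [hx2, norm_expPi]) (by
      rw [hx2, norm_expPi]; exact exp_neg_mul_pi_le_exp_neg_mul_pi (by norm_num)) hu v w
  rw [← neg_four_mul_sub_one] at h
  refine ((isBigO_pi_pow_sub_combinedLambert hk).trans ?_).trans_isLittleO h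
  refine IsBigO.of_bound 1 (Eventually.of_forall fun N => ?_)
  rw [hx2, ← Real.exp_nat_mul, Real.norm_of_nonneg (Real.exp_nonneg _),
    Real.norm_of_nonneg (Real.exp_nonneg _), one_mul]
  refine Real.exp_le_exp.mpr ?_
  have := Real.pi_pos
  have h1 : 0 ≤ Real.pi * N := by positivity
  linarith

end Estimates

/-! ### Numerical values for $k=1$. -/

section CaseOne

open Complex

theorem bernoulli_four : bernoulli 4 = -1 / 30 := by
  rw [bernoulli_eq_bernoulli'_of_ne_one (by norm_num), bernoulli'_four]

theorem bernoulli_six : bernoulli 6 = 1 / 42 := by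
  have h5 : bernoulli' 5 = 0 := bernoulli'_eq_zero_of_odd (by decide) (by norm_num)
  rw [bernoulli_eq_bernoulli'_of_ne_one (by norm_num), bernoulli'_def]
  norm_num [Finset.sum_range_succ, h5, show Nat.choose 6 2 = 15 by decide,
    show Nat.choose 6 4 = 15 by decide]

theorem bernoulliSum_one (c : ℕ → ℂ) : bernoulliSum 1 c = -c 0 / 30240 - c 1 / 8640 := by
  rw [bernoulliSum, Finset.sum_range_succ, Finset.sum_range_one]
  norm_num [bernoulli_two, bernoulli_four, bernoulli_six, Nat.factorial]
  ring

/-- Inverses are needed because $j=0$ brings in the exponent $2j-1=-1$. -/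
theorem inv_one_add_I : (1 + I)⁻¹ = (1 - I) / 2 :=
  inv_eq_of_mul_eq_one_right (by linear_combination (-1 / 2 : ℂ) * I_sq)

theorem inv_one_sub_I : (1 - I)⁻¹ = (1 + I) / 2 :=
  inv_eq_of_mul_eq_one_right (by linear_combination (-1 / 2 : ℂ) * I_sq)

theorem inv_one_add_two_I : (1 + 2 * I)⁻¹ = (1 - 2 * I) / 5 :=
  inv_eq_of_mul_eq_one_right (by linear_combination (-4 / 5 : ℂ) * I_sq)

theorem inv_one_sub_two_I : (1 - 2 * I)⁻¹ = (1 + 2 * I) / 5 :=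
  inv_eq_of_mul_eq_one_right (by linear_combination (-4 / 5 : ℂ) * I_sq)

theorem bernoulliSum_one_twoBracket : bernoulliSum 1 (twoBracket 1) = 5 / 21504 := by
  have e1 : (1 + I) ^ (-1 : ℤ) = (1 - I) / 2 := by rw [zpow_neg_one, inv_one_add_I]
  have e2 : (1 + I) ^ (5 : ℤ) = -4 - 4 * I := by
    rw [zpow_ofNat]
    linear_combination (I ^ 3 + 5 * I ^ 2 + 9 * I + 5) * I_sq
  have e3 : (1 + I) ^ (3 : ℤ) = -2 + 2 * I := by
    rw [zpow_ofNat]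
    linear_combination (I + 3) * I_sq
  rw [bernoulliSum_one, twoBracket, twoBracket]
  norm_num [e1, e2, e3]
  ring

theorem gaussianPowerSum_one (e : ℤ) :
    gaussianPowerSum 1 e = 1 + (1 + I) ^ e + (1 - I) ^ e := by
  have h : Finset.Icc (-1 : ℤ) 1 = {0, 1, -1} := by decide
  rw [gaussianPowerSum, h, Finset.sum_insert (by decide), Finset.sum_insert (by decide),
    Finset.sum_singleton]
  simp [sub_eq_add_neg, add_assoc]

theorem gaussianPowerSum_two_eq (e : ℤ) : gaussianPowerSum 2 e =
    gaussianPowerSum 1 e + (1 + 2 * I) ^ e + (1 - 2 * I) ^ e := by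
  have h : Finset.Icc (-2 : ℤ) 2 = {0, 1, -1, 2, -2} := by decide
  rw [gaussianPowerSum_one, gaussianPowerSum, h, Finset.sum_insert (by decide),
    Finset.sum_insert (by decide), Finset.sum_insert (by decide), Finset.sum_insert (by decide),
    Finset.sum_singleton]
  simp [sub_eq_add_neg, add_assoc, mul_comm I 2]

theorem gaussianPowerSum_one_values :
    gaussianPowerSum 1 (-1) = 2 ∧ gaussianPowerSum 1 1 = 3 ∧ gaussianPowerSum 1 3 = -3 ∧
      gaussianPowerSum 1 5 = -7 := by
  simp only [gaussianPowerSum_one, zpow_neg_one, zpow_ofNat, inv_one_add_I,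
    inv_one_sub_I]
  refine ⟨by ring, by ring, ?_, ?_⟩
  · linear_combination (6 : ℂ) * I_sq
  · linear_combination (10 * I ^ 2 + 10) * I_sq

theorem gaussianPowerSum_two_values :
    gaussianPowerSum 2 (-1) = 12 / 5 ∧ gaussianPowerSum 2 1 = 5 ∧ gaussianPowerSum 2 3 = -25 ∧
      gaussianPowerSum 2 5 = 75 := by
  obtain ⟨h1, h2, h3, h4⟩ := gaussianPowerSum_one_values
  simp only [gaussianPowerSum_two_eq, h1, h2, h3, h4, zpow_neg_one, zpow_ofNat,
    inv_one_add_two_I, inv_one_sub_two_I]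
  refine ⟨by ring, by ring, ?_, ?_⟩
  · linear_combination (24 : ℂ) * I_sq
  · linear_combination (160 * I ^ 2 - 80) * I_sq

theorem bernoulliSum_one_oddBracket_three : bernoulliSum 1 (oddBracket 3 1 1) = 241 / 9072 := by
  obtain ⟨h1, h2, h3, h4⟩ := gaussianPowerSum_one_values
  rw [bernoulliSum_one, oddBracket, oddBracket]
  norm_num [h1, h2, h3, h4]

theorem bernoulliSum_one_oddBracket_five : bernoulliSum 1 (oddBracket 5 2 1) = 337 / 1008 := by
  obtain ⟨h1, h2, h3, h4⟩ := gaussianPowerSum_two_values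
  rw [bernoulliSum_one, oddBracket, oddBracket]
  norm_num [h1, h2, h3, h4]

theorem threeA_one : threeA 1 = 3904 / 37 := by
  norm_num [threeA]

theorem threeB_one : threeB 1 = 355 / 37 := by
  norm_num [threeB_eq, threeA_one]

theorem fiveA_one : fiveA 1 = 37 / 50240 := by
  have h := one_add_two_I_pow_four_mul_add 1
  -- This evaluates $2\cdot 5^2\cos(4\arctan2)=-14$ algebraically.
  have h1 : (1 + 2 * I) ^ (4 * 1) + (1 - 2 * I) ^ (4 * 1) = -14 := by
    linear_combination (32 * I ^ 2 + 16) * I_sq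
  rw [fiveA, ← h, h1]
  norm_num

theorem fiveB_one : fiveB 1 = 3251 / 50240 := by
  norm_num [fiveB_eq, fiveA_one]

theorem threePi_one : threePi 1 = 682 / 201285 := by
  have h : bernoulliSum 1 (threeC 1) = bernoulliSum 1 (oddBracket 3 1 1) -
      threeA 1 * bernoulliSum 1 (twoBracket 1) := by
    rw [← bernoulliSum_mul_left, ← bernoulliSum_sub]
    rfl
  rw [threePi, h, bernoulliSum_one_oddBracket_three, bernoulliSum_one_twoBracket, threeA_one,
    threeB_one]
  norm_num

theorem fivePi_one : fivePi 1 = 694 / 204813 := by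
  have h : bernoulliSum 1 (fiveC 1) = fiveA 1 * bernoulliSum 1 (oddBracket 5 2 1) -
      bernoulliSum 1 (twoBracket 1) := by
    rw [← bernoulliSum_mul_left, ← bernoulliSum_sub]
    rfl
  rw [fivePi, h, bernoulliSum_one_oddBracket_five, bernoulliSum_one_twoBracket, fiveA_one,
    fiveB_one]
  norm_num

theorem combinedLambert_one (F : ℂ → ℂ) : combinedLambert 1 F =
    -3686634 * F (-expPi 3) + 2463048 * F (expPi 4) + 402570 * F (-expPi 5) +
      1843317 / 2 * F (expPi 6) - 201285 / 2 * F (expPi 10) := by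
  rw [combinedLambert, threePi_one, fivePi_one, threeLambert_eq one_pos, fiveLambert_eq one_pos,
    threeB_one, fiveB_one, fiveA_one]
  ring

end CaseOne

theorem mainTheorem12 :
    (∀ k : ℕ, 1 ≤ k →
      -- the two formulas for `ζ(4k + 1)`
      riemannZeta (4 * (k : ℂ) + 1) =
          threePi k * (Real.pi : ℂ) ^ (4 * k + 1) +
            threeLambert k (fun q => lambertL q (-4 * (k : ℂ) - 1)) ∧
      riemannZeta (4 * (k : ℂ) + 1) =
          fivePi k * (Real.pi : ℂ) ^ (4 * k + 1) +
            fiveLambert k (fun q => lambertL q (-4 * (k : ℂ) - 1)) ∧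
      -- they can be solved for `π ^ (4k + 1)`
      threePi k ≠ fivePi k ∧
      (Real.pi : ℂ) ^ (4 * k + 1) =
          combinedLambert k (fun q => lambertL q (-4 * (k : ℂ) - 1)) ∧
      -- the rate of convergence of the resulting series
      (fun N : ℕ => (Real.pi : ℂ) ^ (4 * k + 1) -
          combinedLambert k (fun q => lambertPartial q (-4 * (k : ℂ) - 1) N))
        =O[Filter.atTop] (fun N : ℕ => Real.exp (-(3 * Real.pi * N))) ∧
      -- it is faster than that of any series built on the nomes
      -- `e ^ (-π)`, `e ^ (-2π)`, `e ^ (-4π)` in which the first one occurs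
      (∀ u v w : ℂ, u ≠ 0 →
        (fun N : ℕ => (Real.pi : ℂ) ^ (4 * k + 1) -
            combinedLambert k (fun q => lambertPartial q (-4 * (k : ℂ) - 1) N))
          =o[Filter.atTop]
        (fun N : ℕ =>
          (u * lambertL (expPi 1) (-4 * (k : ℂ) - 1) +
            v * lambertL (expPi 2) (-4 * (k : ℂ) - 1) +
            w * lambertL (expPi 4) (-4 * (k : ℂ) - 1)) -
          (u * lambertPartial (expPi 1) (-4 * (k : ℂ) - 1) N +
            v * lambertPartial (expPi 2) (-4 * (k : ℂ) - 1) N +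
            w * lambertPartial (expPi 4) (-4 * (k : ℂ) - 1) N)))) ∧
    -- the case `k = 1`
    (∀ F : ℂ → ℂ, combinedLambert 1 F =
      -3686634 * F (-expPi 3) + 2463048 * F (expPi 4) + 402570 * F (-expPi 5) +
        1843317 / 2 * F (expPi 6) - 201285 / 2 * F (expPi 10)) ∧
    (Real.pi : ℂ) ^ 5 =
      -3686634 * lambertL (-expPi 3) (-5) + 2463048 * lambertL (expPi 4) (-5) +
        402570 * lambertL (-expPi 5) (-5) + 1843317 / 2 * lambertL (expPi 6) (-5) -
        201285 / 2 * lambertL (expPi 10) (-5) := by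
  refine ⟨fun k hk => ⟨riemannZeta_eq_threePi hk, riemannZeta_eq_fivePi hk, threePi_ne_fivePi hk,
    pi_pow_eq_combinedLambert hk, isBigO_pi_pow_sub_combinedLambert hk,
    fun u v w hu => isLittleO_pi_pow_sub_combinedLambert hk hu v w⟩, combinedLambert_one, ?_⟩
  have h := pi_pow_eq_combinedLambert one_pos
  rw [combinedLambert_one] at h
  norm_num at h ⊢
  exact h
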